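/- Let $d\ge 1$ and let $\mathbb{R}^{d+1}$ be the space of points $z=(t,x)$, $t\in\mathbb{R}$, $x\in\mathbb{R}^d$, with Lebesgue measure. For $\rho>0$ put $C_\rho(t,x)=\{(s,y): |x-y|<\rho,\ t\le s<t+\rho^2\}$. For $q\ge 1$ let $E_{q,1}$ be the space of measurable (real- or $\mathbb{R}^m$-valued) functions $b$ on $\mathbb{R}^{d+1}$ with $$\|b\|_{E_{q,1}}:=\sup_{0<\rho<\infty,\ z\in\mathbb{R}^{d+1}}\rho\,\Big(\frac{1}{|C_\rho(z)|}\int_{C_\rho(z)}|b|^q\,dw\Big)^{1/q}<\infty .$$ For measurable $f\ge 0$ on $\mathbb{R}^{d+1}$ put $$P_1f(t,x)=\int_0^\infty\!\!\int_{\mathbb{R}^d}\frac{1}{s^{(d+1)/2}}\,e^{-|y|^2/s}\,f(t+s,x+y)\,dy\,ds\in[0,\infty].$$ Theorem. Let $d+2\ge q>p>1$. There is a constant $N<\infty$ depending only on $d,p,q$ such that for every $b\in E_{q,1}$: (i) for every measurable $f\ge 0$, $$\int_{\mathbb{R}^{d+1}}|b|^p(P_1f)^p\,dz\le N\,\|b\|_{E_{q,1}}^p\,\|f\|_{L_p(\mathbb{R}^{d+1})}^p$$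 (with the convention $0\cdot\infty=0$ on the right); (ii) for every $u\in C_0^\infty(\mathbb{R}^{d+1})$, with $Du$ and $D^2u$ the gradient and the Hessian of $u$ in $x$, $$\int_{\mathbb{R}^{d+1}}|b|^p|Du|^p\,dz\le N\,\|b\|_{E_{q,1}}^p\int_{\mathbb{R}^{d+1}}\big(|D^2u|^2+|\partial_tu|^2\big)^{p/2}\,dz ,$$ where $|D^2u|^2=\sum_{i,j}|D_iD_ju|^2$. -/

import Mathlib

open MeasureTheory
open scoped ENNReal NNReal ContDiff

noncomputable section

namespace ParabolicMorrey

/-- The space `ℝ^{d+1}` of points `z = (t, x)`, `t ∈ ℝ`, `x ∈ ℝ^d`; its measure `volume` is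
Lebesgue measure `dx dt`. -/
abbrev Spacetime (d : ℕ) : Type := ℝ × EuclideanSpace ℝ (Fin d)

/-- The parabolic cylinder `C_ρ(t, x) = {(s, y) : |x - y| < ρ, t ≤ s < t + ρ ^ 2}`. -/
def paraCylinder {d : ℕ} (ρ : ℝ) (z : Spacetime d) : Set (Spacetime d) :=
  {w | ‖z.2 - w.2‖ < ρ ∧ z.1 ≤ w.1 ∧ w.1 < z.1 + ρ ^ 2}

/-- The Morrey norm
`sup_{0 < ρ < ∞, z} ρ ^ β * (|C_ρ(z)|⁻¹ ∫_{C_ρ(z)} |g| ^ q) ^ (1 / q)`, with values in `[0, ∞]`. -/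
def morreyNorm {d m : ℕ} (q β : ℝ) (g : Spacetime d → EuclideanSpace ℝ (Fin m)) : ℝ≥0∞ :=
  ⨆ (ρ : ℝ) (_ : 0 < ρ) (z : Spacetime d),
    ENNReal.ofReal (ρ ^ β) * (⨍⁻ w in paraCylinder ρ z, ‖g w‖ₑ ^ q ∂volume) ^ (1 / q)

/-- Membership in the parabolic Morrey space `E_{q,β}` on the whole space. -/
def MemMorrey {d m : ℕ} (q β : ℝ) (g : Spacetime d → EuclideanSpace ℝ (Fin m)) : Prop :=
  AEStronglyMeasurable g volume ∧ morreyNorm q β g < (⊤ : ℝ≥0∞)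

/-- The kernel `p_α(s, r) = s ^ (-(d + 2 - α) / 2) * exp (-r ^ 2 / s)` for `s > 0`, and `0` for
`s ≤ 0`. -/
def kernel (d : ℕ) (α s r : ℝ) : ℝ :=
  if 0 < s then (1 / s ^ (((d : ℝ) + 2 - α) / 2)) * Real.exp (-r ^ 2 / s) else 0

/-- The parabolic potential
`P_α f (t, x) = ∫ p_α(s, |y|) f (t + s, x + y) dy ds` of a function with values in `[0, ∞]`. -/
def potential {d : ℕ} (α : ℝ) (f : Spacetime d → ℝ≥0∞) (z : Spacetime d) : ℝ≥0∞ :=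
  ∫⁻ w : Spacetime d, ENNReal.ofReal (kernel d α w.1 ‖w.2‖) * f (z + w)

/-- The time derivative `∂_t u`. -/
def timeDeriv {d : ℕ} (u : Spacetime d → ℝ) (z : Spacetime d) : ℝ :=
  lineDeriv ℝ u z (1, 0)

/-- The spatial partial derivative `D_i u`. -/
def spaceDeriv {d : ℕ} (i : Fin d) (u : Spacetime d → ℝ) (z : Spacetime d) : ℝ :=
  lineDeriv ℝ u z (0, EuclideanSpace.single i 1)

/-- The spatial gradient `Du = (D_1 u, …, D_d u)`. -/
def spaceGrad {d : ℕ} (u : Spacetime d → ℝ) (z : Spacetime d) : EuclideanSpace ℝ (Fin d) :=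
  WithLp.toLp 2 fun i => spaceDeriv i u z

/-- The Euclidean length `|(D²u, ∂_t u)|` of the array of all `D_i D_j u` and `∂_t u`. -/
def hessTimeNorm {d : ℕ} (u : Spacetime d → ℝ) (z : Spacetime d) : ℝ :=
  Real.sqrt ((∑ i : Fin d, ∑ j : Fin d, spaceDeriv i (spaceDeriv j u) z ^ 2) + timeDeriv u z ^ 2)

end ParabolicMorrey

end

/-!
Both `P_α f` and `|Du|` are dominated pointwise by a dyadic Riesz potential over parabolic balls,
`I_α f (z) = ∑_k 2 ^ (α k) ⨍_{B(z, 2 ^ k)} f`. For `P_α` this is a bound on the kernel. For `Du`,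
with `α = 1` and `f = |(D²u, ∂_t u)|`, one telescopes weighted averages of `D_i u` over the dyadic
scales: the derivative in the scale of such an average is again an average, of second space
derivatives and of `∂_t D_i u`, and in the latter `D_i` is moved onto the weight by parts.

It remains to bound `b I_α f` in `L_p`. A Carleson-type covering argument gives
`∫ h I_α f ≲ ∫ M f · M_α h` for `h ≥ 0`, with `M` the maximal and `M_α` the fractional maximal
function. For `h = |b| g`, Hölder's inequality on each ball gives
`M_α (|b| g) ≤ ‖b‖ (M (g ^ q')) ^ (1 / q')` with the Morrey norm of `b`, and since `p < q` means
`p' / q' > 1`, the maximal theorem in `L_p` and in `L_{p' / q'}` bounds `∫ g |b| I_α f` by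
`‖b‖ ‖f‖_p ‖g‖_{p'}`. Duality concludes.
-/

noncomputable section

open Set Filter Metric Topology TopologicalSpace

namespace ParabolicMorrey

/-! ### Dyadic layers and duality -/

section DyadicLayer

/-- The sum `∑_{i ≥ 0} 2 ^ (-s i)` of the geometric series. -/
def geomConst (s : ℝ) : ℝ≥0∞ := (1 - (2 : ℝ≥0∞) ^ (-s))⁻¹

lemma geomConst_ne_top {s : ℝ} (hs : 0 < s) : geomConst s ≠ ⊤ :=
  ENNReal.inv_ne_top.2 (tsub_pos_of_lt
    (ENNReal.rpow_lt_one_of_one_lt_of_neg ENNReal.one_lt_two (neg_neg_of_pos hs))).ne'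

lemma geomConst_ne_zero (s : ℝ) : geomConst s ≠ 0 := by
  simp [geomConst]

lemma two_zpow_ne_top (j : ℤ) : (2 : ℝ≥0∞) ^ j ≠ ⊤ :=
  ENNReal.zpow_ne_top two_ne_zero ENNReal.ofNat_ne_top j

lemma ofReal_two_zpow (k : ℤ) : ENNReal.ofReal ((2 : ℝ) ^ k) = 2 ^ k := by
  rw [← Real.rpow_intCast, ← ENNReal.rpow_intCast, ← ENNReal.ofReal_rpow_of_pos two_pos,
    ENNReal.ofReal_ofNat]

lemma two_zpow_add_one (j : ℤ) : (2 : ℝ≥0∞) ^ (j + 1) = 2 * 2 ^ j := by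
  rw [ENNReal.zpow_add two_ne_zero ENNReal.ofNat_ne_top, zpow_one, mul_comm]

lemma tsum_two_zpow_rpow_of_le (n : ℤ) (s : ℝ) :
    ∑' j : ℤ, (if j ≤ n then ((2 : ℝ≥0∞) ^ j) ^ s else 0) = geomConst s * ((2 : ℝ≥0∞) ^ n) ^ s := by
  have hinj : Function.Injective (fun i : ℕ => n - (i : ℤ)) := fun a b h => by
    simpa using h
  have hsupp : Function.support (fun j : ℤ => if j ≤ n then ((2 : ℝ≥0∞) ^ j) ^ s else 0) ⊆
      range (fun i : ℕ => n - (i : ℤ)) := fun j hj => by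
    have hjn : j ≤ n := by
      by_contra h
      exact hj (if_neg h)
    exact ⟨(n - j).toNat, by simp only; omega⟩
  rw [← hinj.tsum_eq hsupp, geomConst, ← ENNReal.tsum_geometric, ← ENNReal.tsum_mul_right]
  refine tsum_congr fun i => ?_
  rw [if_pos (by omega)]
  simp only [← ENNReal.rpow_intCast, ← ENNReal.rpow_natCast, ← ENNReal.rpow_mul]
  rw [← ENNReal.rpow_add _ _ two_ne_zero ENNReal.ofNat_ne_top]
  congr 1
  push_cast
  ring

/-- The dyadic layer sum `∑_{2 ^ j < x} 2 ^ (s j)`, a discrete substitute for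
`x ^ s = s ∫_0^x c ^ (s - 1) dc`. -/
def dyadicLayer (s : ℝ) (x : ℝ≥0∞) : ℝ≥0∞ :=
  ∑' j : ℤ, if (2 : ℝ≥0∞) ^ j < x then ((2 : ℝ≥0∞) ^ j) ^ s else 0

lemma dyadicLayer_le {s : ℝ} (hs : 0 < s) (x : ℝ≥0∞) : dyadicLayer s x ≤ geomConst s * x ^ s := by
  rcases eq_or_ne x 0 with rfl | h0
  · simp [dyadicLayer]
  rcases eq_or_ne x ⊤ with rfl | ht
  · simp [ENNReal.top_rpow_of_pos hs, ENNReal.mul_top (geomConst_ne_zero s)]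
  obtain ⟨n, hn, hn'⟩ :=
    ENNReal.exists_mem_Ioc_zpow h0 ht ENNReal.one_lt_two ENNReal.ofNat_ne_top
  calc dyadicLayer s x ≤ ∑' j : ℤ, (if j ≤ n then ((2 : ℝ≥0∞) ^ j) ^ s else 0) := by
        refine ENNReal.tsum_le_tsum fun j => ?_
        split_ifs with hjx hjn
        · exact le_rfl
        · exact absurd (hjx.trans_le hn')
            (ENNReal.zpow_le_of_le one_le_two (by omega : n + 1 ≤ j)).not_gt
        · exact zero_le
        · exact le_rfl
    _ = geomConst s * ((2 : ℝ≥0∞) ^ n) ^ s := tsum_two_zpow_rpow_of_le n s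
    _ ≤ geomConst s * x ^ s := by gcongr

lemma dyadicLayer_top {s : ℝ} (hs : 0 < s) : dyadicLayer s ⊤ = ⊤ := by
  refine top_unique ?_
  calc (⊤ : ℝ≥0∞) = ∑' _ : ℕ, 1 := (ENNReal.tsum_const_eq_top_of_ne_zero one_ne_zero).symm
    _ ≤ ∑' n : ℕ, (if (2 : ℝ≥0∞) ^ (n : ℤ) < ⊤ then ((2 : ℝ≥0∞) ^ (n : ℤ)) ^ s else 0) := by
        refine ENNReal.tsum_le_tsum fun n => ?_
        rw [if_pos (two_zpow_ne_top n).lt_top, zpow_natCast]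
        exact ENNReal.one_le_rpow (one_le_pow₀ one_le_two) hs
    _ ≤ dyadicLayer s ⊤ := ENNReal.tsum_comp_le_tsum_of_injective Nat.cast_injective _

lemma rpow_le_dyadicLayer {s : ℝ} (hs : 0 < s) (x : ℝ≥0∞) :
    x ^ s ≤ 2 ^ s * dyadicLayer s x := by
  rcases eq_or_ne x 0 with rfl | h0
  · simp [ENNReal.zero_rpow_of_pos hs]
  rcases eq_or_ne x ⊤ with rfl | ht
  · rw [dyadicLayer_top hs, ENNReal.mul_top (by simp)]
    exact le_top
  obtain ⟨n, hn, hn'⟩ :=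
    ENNReal.exists_mem_Ioc_zpow h0 ht ENNReal.one_lt_two ENNReal.ofNat_ne_top
  calc x ^ s ≤ ((2 : ℝ≥0∞) ^ (n + 1)) ^ s := by gcongr
    _ = 2 ^ s * ((2 : ℝ≥0∞) ^ n) ^ s := by
        rw [two_zpow_add_one, ENNReal.mul_rpow_of_nonneg _ _ hs.le]
    _ ≤ 2 ^ s * dyadicLayer s x := by
        gcongr
        refine le_trans ?_ (ENNReal.le_tsum n)
        rw [if_pos hn]

variable {X : Type*} [MeasurableSpace X] {μ : Measure X} {f g F : X → ℝ≥0∞}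

lemma lintegral_dyadicLayer_mul (s : ℝ) (hF : AEMeasurable F μ) (hg : AEMeasurable g μ) :
    ∫⁻ x, dyadicLayer s (F x) * g x ∂μ =
      ∑' j : ℤ, ((2 : ℝ≥0∞) ^ j) ^ s * ∫⁻ x in {x | (2 : ℝ≥0∞) ^ j < F x}, g x ∂μ := by
  have hlevel (j : ℤ) : NullMeasurableSet {x | (2 : ℝ≥0∞) ^ j < F x} μ :=
    nullMeasurableSet_lt aemeasurable_const hF
  have hterm (j : ℤ) (x : X) : (if (2 : ℝ≥0∞) ^ j < F x then ((2 : ℝ≥0∞) ^ j) ^ s else 0) * g x =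
      ((2 : ℝ≥0∞) ^ j) ^ s * {x | (2 : ℝ≥0∞) ^ j < F x}.indicator g x := by
    by_cases h : (2 : ℝ≥0∞) ^ j < F x <;> simp [h]
  simp_rw [dyadicLayer, ← ENNReal.tsum_mul_right, hterm]
  rw [lintegral_tsum fun j => (hg.indicator₀ (hlevel j)).const_mul _]
  refine tsum_congr fun j => ?_
  rw [lintegral_const_mul'' _ (hg.indicator₀ (hlevel j)), lintegral_indicator₀ (hlevel j)]

lemma rpow_sub_one_mul_self {s : ℝ} (hs : 1 ≤ s) (x : ℝ≥0∞) : x ^ (s - 1) * x = x ^ s := by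
  conv_lhs => rw [← ENNReal.rpow_one x, ← ENNReal.rpow_mul, one_mul]
  rw [← ENNReal.rpow_add_of_nonneg _ _ (sub_nonneg.2 hs) zero_le_one, sub_add_cancel]

/-- The truncated weak-type bound is what the Marcinkiewicz interpolation theorem extracts from
weak type `(1, 1)` and strong type `(∞, ∞)`. -/
lemma lintegral_rpow_le_of_weakType {s : ℝ} (hs : 1 < s) {A : ℝ≥0∞} (hF : AEMeasurable F μ)
    (hf : AEMeasurable f μ)
    (hweak : ∀ c : ℝ≥0∞, c * μ {x | c < F x} ≤ A * ∫⁻ x in {x | c < 2 * f x}, f x ∂μ) :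
    ∫⁻ x, F x ^ s ∂μ ≤ 2 ^ s * A * geomConst (s - 1) * 2 ^ (s - 1) * ∫⁻ x, f x ^ s ∂μ := by
  have hs0 : 0 < s := one_pos.trans hs
  have hs1 : 0 < s - 1 := sub_pos.2 hs
  have hlayer : ∫⁻ x, dyadicLayer s (F x) ∂μ ≤
      A * ∫⁻ x, dyadicLayer (s - 1) (2 * f x) * f x ∂μ := by
    have h := lintegral_dyadicLayer_mul s hF (aemeasurable_const (b := (1 : ℝ≥0∞)))
    simp only [mul_one, setLIntegral_one] at h
    rw [h, lintegral_dyadicLayer_mul _ (hf.const_mul 2) hf, ← ENNReal.tsum_mul_left]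
    refine ENNReal.tsum_le_tsum fun j => ?_
    rw [← rpow_sub_one_mul_self hs.le, mul_assoc, mul_left_comm A]
    exact mul_le_mul_right (hweak _) _
  have htop : 2 ^ s ≠ (⊤ : ℝ≥0∞) := ENNReal.rpow_ne_top_of_nonneg hs0.le ENNReal.ofNat_ne_top
  calc ∫⁻ x, F x ^ s ∂μ ≤ ∫⁻ x, 2 ^ s * dyadicLayer s (F x) ∂μ :=
        lintegral_mono fun x => rpow_le_dyadicLayer hs0 (F x)
    _ = 2 ^ s * ∫⁻ x, dyadicLayer s (F x) ∂μ := lintegral_const_mul' _ _ htop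
    _ ≤ 2 ^ s * (A * ∫⁻ x, geomConst (s - 1) * 2 ^ (s - 1) * f x ^ s ∂μ) := by
        refine mul_le_mul_right (hlayer.trans (mul_le_mul_right (lintegral_mono fun x => ?_) A)) _
        calc dyadicLayer (s - 1) (2 * f x) * f x
            ≤ geomConst (s - 1) * (2 * f x) ^ (s - 1) * f x :=
              mul_le_mul_left (dyadicLayer_le hs1 _) _
          _ = geomConst (s - 1) * 2 ^ (s - 1) * f x ^ s := by
              rw [ENNReal.mul_rpow_of_nonneg _ _ hs1.le, ← mul_assoc, mul_assoc _ _ (f x),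
                rpow_sub_one_mul_self hs.le]
    _ = 2 ^ s * A * geomConst (s - 1) * 2 ^ (s - 1) * ∫⁻ x, f x ^ s ∂μ := by
        rw [lintegral_const_mul'' _ (hf.pow_const s)]
        ring

end DyadicLayer

section Duality

lemma le_rpow_of_le_mul_rpow {p p' : ℝ} (hpp : p.HolderConjugate p') {a D : ℝ≥0∞} (ha : a ≠ ⊤)
    (h : a ≤ D * a ^ (1 / p')) : a ≤ D ^ p := by
  rcases eq_or_ne a 0 with rfl | h0
  · exact zero_le
  have hne : a ^ (1 / p') ≠ 0 := by simp [ENNReal.rpow_eq_zero_iff, h0, ha]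
  have htop : a ^ (1 / p') ≠ ⊤ :=
    ENNReal.rpow_ne_top_of_nonneg (one_div_nonneg.2 hpp.symm.nonneg) ha
  have hsplit : a ^ p⁻¹ * a ^ (1 / p') = a := by
    rw [← ENNReal.rpow_add _ _ h0 ha, one_div, hpp.inv_add_inv_eq_one, ENNReal.rpow_one]
  rw [← ENNReal.rpow_inv_le_iff hpp.pos]
  refine (ENNReal.mul_le_mul_iff_left hne htop).1 ?_
  rwa [hsplit]

variable {X : Type*} [MeasurableSpace X] {μ : Measure X}

lemma lintegral_rpow_le_of_forall_lintegral_mul_le [SigmaFinite μ] {p p' : ℝ}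
    (hpp : p.HolderConjugate p') {w : X → ℝ≥0∞} {D : ℝ≥0∞}
    (h : ∀ g : X → ℝ≥0∞, Measurable g →
      ∫⁻ x, g x * w x ∂μ ≤ D * (∫⁻ x, g x ^ p' ∂μ) ^ (1 / p')) :
    ∫⁻ x, w x ^ p ∂μ ≤ D ^ p := by
  by_contra! hlt
  simp_rw [lintegral_eq_nnreal, lt_iSup_iff, ← SimpleFunc.lintegral_eq_lintegral,
    SimpleFunc.map_apply] at hlt
  obtain ⟨φ, hφw, hlt⟩ := hlt
  obtain ⟨g, hgφ, hgtop, hlt⟩ := SimpleFunc.exists_lt_lintegral_simpleFunc_of_lt_lintegral hlt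
  have hgw (x : X) : (g x : ℝ≥0∞) ^ (1 / p) ≤ w x := by
    rw [one_div, ENNReal.rpow_inv_le_iff hpp.pos]
    exact (ENNReal.coe_le_coe.2 (hgφ x)).trans (hφw x)
  refine hlt.not_ge (le_rpow_of_le_mul_rpow hpp hgtop.ne ?_)
  calc ∫⁻ x, g x ∂μ = ∫⁻ x, (g x : ℝ≥0∞) ^ (1 / p') * (g x : ℝ≥0∞) ^ (1 / p) ∂μ := by
        refine lintegral_congr fun x => ?_
        rw [← ENNReal.rpow_add_of_nonneg _ _ (one_div_nonneg.2 hpp.symm.nonneg)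
          (one_div_nonneg.2 hpp.nonneg), one_div, one_div, hpp.symm.inv_add_inv_eq_one,
          ENNReal.rpow_one]
    _ ≤ ∫⁻ x, (g x : ℝ≥0∞) ^ (1 / p') * w x ∂μ := by
        gcongr with x
        exact hgw x
    _ ≤ D * (∫⁻ x, ((g x : ℝ≥0∞) ^ (1 / p')) ^ p' ∂μ) ^ (1 / p') :=
        h _ (g.measurable.coe_nnreal_ennreal.pow_const _)
    _ = D * (∫⁻ x, g x ∂μ) ^ (1 / p') := by
        simp_rw [← ENNReal.rpow_mul, one_div_mul_cancel hpp.symm.ne_zero, ENNReal.rpow_one]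

end Duality

/-! ### Maximal functions and Riesz potentials on doubling spaces -/

section Doubling

lemma setLAverage_le_of_subset {X : Type*} [MeasurableSpace X] {μ : Measure X} {s t : Set X}
    {K : ℝ≥0∞} (hst : s ⊆ t) (ht : μ t ≠ ⊤) (hK : μ t ≤ K * μ s)
    (f : X → ℝ≥0∞) : ⨍⁻ x in s, f x ∂μ ≤ K * ⨍⁻ x in t, f x ∂μ := by
  rw [setLAverage_eq]
  refine ENNReal.div_le_of_le_mul ?_
  calc ∫⁻ x in s, f x ∂μ ≤ ∫⁻ x in t, f x ∂μ := lintegral_mono_set hst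
    _ = μ t * ⨍⁻ x in t, f x ∂μ := (measure_mul_setLAverage f ht).symm
    _ ≤ K * μ s * ⨍⁻ x in t, f x ∂μ := mul_le_mul_left hK _
    _ = K * (⨍⁻ x in t, f x ∂μ) * μ s := by ring

variable {X : Type*} [PseudoMetricSpace X]

lemma exists_countable_disjoint_balls [SeparableSpace X] {ι : Type*} {t : Set ι} {x : ι → X}
    {r : ι → ℝ} {R : ℝ} (hpos : ∀ a ∈ t, 0 < r a) (hR : ∀ a ∈ t, r a ≤ R) :
    ∃ u ⊆ t, u.Countable ∧ (u.PairwiseDisjoint fun a => ball (x a) (r a)) ∧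
      ∀ a ∈ t, ∃ b ∈ u, dist (x a) (x b) < r a + r b ∧ r a ≤ 3 / 2 * r b := by
  obtain ⟨u, hut, hdisj, hu⟩ := Vitali.exists_disjoint_subfamily_covering_enlargement
    (fun a => ball (x a) (r a)) t r (3 / 2) (by norm_num) (fun a ha => (hpos a ha).le) R hR
    fun a ha => nonempty_ball.2 (hpos a ha)
  refine ⟨u, hut, hdisj.countable_of_isOpen (fun _ _ => isOpen_ball)
    fun a ha => nonempty_ball.2 (hpos a (hut ha)), hdisj, fun a ha => ?_⟩
  obtain ⟨b, hb, ⟨y, hya, hyb⟩, hrb⟩ := hu a ha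
  exact ⟨b, hb, dist_triangle_left (x a) (x b) y |>.trans_lt (add_lt_add hya hyb), hrb⟩

lemma exists_countable_disjoint_dyadic_balls [SeparableSpace X] {T : Set (X × ℤ)} {n : ℤ}
    (hn : ∀ a ∈ T, a.2 ≤ n) :
    ∃ u ⊆ T, u.Countable ∧ (u.PairwiseDisjoint fun a => ball a.1 ((2 : ℝ) ^ a.2)) ∧
      ∀ a ∈ T, ∃ b ∈ u, a.2 ≤ b.2 ∧ a.1 ∈ ball b.1 (2 * 2 ^ b.2) := by
  obtain ⟨u, huT, hu, hdisj, hcover⟩ := exists_countable_disjoint_balls (t := T) (x := Prod.fst)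
    (r := fun a => 2 ^ a.2) (R := 2 ^ n) (fun a _ => by positivity)
    fun a ha => zpow_le_zpow_right₀ one_le_two (hn a ha)
  refine ⟨u, huT, hu, hdisj, fun a ha => ?_⟩
  obtain ⟨b, hb, hdist, hrad⟩ := hcover a ha
  have hab : a.2 ≤ b.2 := by
    by_contra! hlt
    have hle : (2 : ℝ) ^ (b.2 + 1) ≤ 2 ^ a.2 := zpow_le_zpow_right₀ one_le_two hlt
    rw [zpow_add_one₀ two_ne_zero] at hle
    have hpos : (0 : ℝ) < 2 ^ b.2 := by positivity
    linarith
  have hle : (2 : ℝ) ^ a.2 ≤ 2 ^ b.2 := zpow_le_zpow_right₀ one_le_two hab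
  exact ⟨b, hb, hab, mem_ball.2 (by linarith)⟩

variable [MeasurableSpace X]

/-- The measure `μ` is doubling with constant `A`: balls have positive and finite measure, and
doubling the radius multiplies the measure by at most `A`. Unlike Mathlib's
`IsUnifLocDoublingMeasure`, this is required at all scales. -/
structure IsDoubling (μ : Measure X) (A : ℝ≥0) : Prop where
  measure_ball_ne_zero : ∀ x r, 0 < r → μ (ball x r) ≠ 0
  measure_ball_ne_top : ∀ x r, μ (ball x r) ≠ ⊤
  measure_ball_two_mul_le : ∀ x r, 0 < r → μ (ball x (2 * r)) ≤ A * μ (ball x r)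

section FracMaximal

/-- The uncentred fractional maximal function `sup r ^ α ⨍_B f` over the balls `B ∋ z`, with `r`
the radius of `B`. For `α = 0` it is the Hardy–Littlewood maximal function. -/
def fracMaximal (μ : Measure X) (α : ℝ) (f : X → ℝ≥0∞) (z : X) : ℝ≥0∞ :=
  ⨆ (w : X) (r : ℝ) (_ : 0 < r) (_ : z ∈ ball w r),
    ENNReal.ofReal r ^ α * ⨍⁻ x in ball w r, f x ∂μ

variable {μ : Measure X} {A : ℝ≥0} {α r : ℝ} {c : ℝ≥0∞} {f : X → ℝ≥0∞} {w z : X}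

lemma le_fracMaximal (hr : 0 < r) (hz : z ∈ ball w r) :
    ENNReal.ofReal r ^ α * ⨍⁻ x in ball w r, f x ∂μ ≤ fracMaximal μ α f z :=
  le_iSup₂_of_le w r (le_iSup₂_of_le hr hz le_rfl)

lemma fracMaximal_le_iff : fracMaximal μ α f z ≤ c ↔
    ∀ w r, 0 < r → z ∈ ball w r → ENNReal.ofReal r ^ α * ⨍⁻ x in ball w r, f x ∂μ ≤ c := by
  simp only [fracMaximal, iSup_le_iff]

lemma lt_fracMaximal_iff : c < fracMaximal μ α f z ↔
    ∃ w r, 0 < r ∧ z ∈ ball w r ∧ c < ENNReal.ofReal r ^ α * ⨍⁻ x in ball w r, f x ∂μ := by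
  simp only [fracMaximal, lt_iSup_iff, exists_prop]

lemma lowerSemicontinuous_fracMaximal (μ : Measure X) (α : ℝ) (f : X → ℝ≥0∞) :
    LowerSemicontinuous (fracMaximal μ α f) := by
  refine lowerSemicontinuous_iff_isOpen_preimage.2 fun c => isOpen_iff_mem_nhds.2 fun z hz => ?_
  obtain ⟨w, r, hr, hzw, hc⟩ := lt_fracMaximal_iff.1 hz
  filter_upwards [isOpen_ball.mem_nhds hzw] with y hy
  exact lt_fracMaximal_iff.2 ⟨w, r, hr, hy, hc⟩

lemma measurable_fracMaximal [OpensMeasurableSpace X] (μ : Measure X) (α : ℝ) (f : X → ℝ≥0∞) :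
    Measurable (fracMaximal μ α f) :=
  (lowerSemicontinuous_fracMaximal μ α f).measurable

lemma fracMaximal_zero_le_indicator_add (f : X → ℝ≥0∞) (c : ℝ≥0∞) (z : X) :
    fracMaximal μ 0 f z ≤ fracMaximal μ 0 ({x | c < f x}.indicator f) z + c := by
  refine fracMaximal_le_iff.2 fun w r hr hz => ?_
  rw [ENNReal.rpow_zero, one_mul]
  calc ⨍⁻ x in ball w r, f x ∂μ
      ≤ ⨍⁻ x in ball w r, ({x | c < f x}.indicator f x + c) ∂μ := by
        refine laverage_mono_ae (ae_of_all _ fun x => ?_)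
        by_cases hx : c < f x
        · simp [hx]
        · exact (not_lt.1 hx).trans le_add_self
    _ = ⨍⁻ x in ball w r, {x | c < f x}.indicator f x ∂μ + ⨍⁻ _ in ball w r, c ∂μ :=
        lintegral_add_right _ measurable_const
    _ ≤ fracMaximal μ 0 ({x | c < f x}.indicator f) z + c := by
        gcongr
        · simpa using le_fracMaximal (μ := μ) (α := 0) (f := {x | c < f x}.indicator f) hr hz
        · rw [setLAverage_eq, setLIntegral_const]
          exact ENNReal.div_le_of_le_mul le_rfl

variable [OpensMeasurableSpace X] [SeparableSpace X]

lemma IsDoubling.mul_measure_biUnion_ball_le (hμ : IsDoubling μ A) {T : Set (X × ℝ)} {R : ℝ}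
    (hpos : ∀ b ∈ T, 0 < b.2) (hR : ∀ b ∈ T, b.2 ≤ R)
    (hT : ∀ b ∈ T, c ≤ ⨍⁻ x in ball b.1 b.2, f x ∂μ) :
    c * μ (⋃ b ∈ T, ball b.1 b.2) ≤ A ^ 2 * ∫⁻ x, f x ∂μ := by
  obtain ⟨u, huT, hu, hdisj, hcover⟩ := exists_countable_disjoint_balls (x := Prod.fst) hpos hR
  have hsub : ⋃ b ∈ T, ball b.1 b.2 ⊆ ⋃ b ∈ u, ball b.1 (2 * (2 * b.2)) := by
    refine iUnion₂_subset fun a ha y hy => ?_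
    obtain ⟨b, hb, hdist, hrad⟩ := hcover a ha
    refine mem_biUnion hb (mem_ball.2 ?_)
    linarith [mem_ball.1 hy, dist_triangle y a.1 b.1]
  have hball (b : X × ℝ) (hb : b ∈ u) :
      c * μ (ball b.1 (2 * (2 * b.2))) ≤ A ^ 2 * ∫⁻ x in ball b.1 b.2, f x ∂μ := by
    have hb0 := hpos b (huT hb)
    calc c * μ (ball b.1 (2 * (2 * b.2)))
        ≤ (⨍⁻ x in ball b.1 b.2, f x ∂μ) * (A * (A * μ (ball b.1 b.2))) := by
          refine mul_le_mul' (hT b (huT hb)) ?_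
          exact (hμ.measure_ball_two_mul_le _ _ (by linarith)).trans
            (mul_le_mul_right (hμ.measure_ball_two_mul_le _ _ hb0) _)
      _ = A ^ 2 * (μ (ball b.1 b.2) * ⨍⁻ x in ball b.1 b.2, f x ∂μ) := by ring
      _ = A ^ 2 * ∫⁻ x in ball b.1 b.2, f x ∂μ := by
          rw [measure_mul_setLAverage _ (hμ.measure_ball_ne_top _ _)]
  calc c * μ (⋃ b ∈ T, ball b.1 b.2)
      ≤ c * ∑' b : u, μ (ball b.1.1 (2 * (2 * b.1.2))) :=
        mul_le_mul_right ((measure_mono hsub).trans (measure_biUnion_le μ hu _)) c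
    _ ≤ ∑' b : u, A ^ 2 * ∫⁻ x in ball b.1.1 b.1.2, f x ∂μ := by
        rw [← ENNReal.tsum_mul_left]
        exact ENNReal.tsum_le_tsum fun b => hball b.1 b.2
    _ = A ^ 2 * ∫⁻ x in ⋃ b ∈ u, ball b.1 b.2, f x ∂μ := by
        rw [ENNReal.tsum_mul_left, lintegral_biUnion hu (fun _ _ => measurableSet_ball) hdisj]
    _ ≤ A ^ 2 * ∫⁻ x, f x ∂μ := mul_le_mul_right (setLIntegral_le_lintegral _ _) _

lemma IsDoubling.mul_measure_lt_fracMaximal_zero_le (hμ : IsDoubling μ A) (f : X → ℝ≥0∞)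
    (c : ℝ≥0∞) : c * μ {z | c < fracMaximal μ 0 f z} ≤ A ^ 2 * ∫⁻ x, f x ∂μ := by
  let T (n : ℕ) : Set (X × ℝ) := {b | 0 < b.2 ∧ b.2 ≤ n ∧ c < ⨍⁻ x in ball b.1 b.2, f x ∂μ}
  have hmono : Monotone fun n => ⋃ b ∈ T n, ball b.1 b.2 := fun m n hmn =>
    biUnion_subset_biUnion_left fun b hb => ⟨hb.1, hb.2.1.trans (Nat.cast_le.2 hmn), hb.2.2⟩
  have hset : {z | c < fracMaximal μ 0 f z} ⊆ ⋃ n, ⋃ b ∈ T n, ball b.1 b.2 := fun z hz => by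
    obtain ⟨w, r, hr, hzw, hc⟩ := lt_fracMaximal_iff.1 hz
    rw [ENNReal.rpow_zero, one_mul] at hc
    obtain ⟨n, hn⟩ := exists_nat_ge r
    exact mem_iUnion.2 ⟨n, mem_biUnion (x := (w, r)) ⟨hr, hn, hc⟩ hzw⟩
  calc c * μ {z | c < fracMaximal μ 0 f z}
      ≤ c * ⨆ n, μ (⋃ b ∈ T n, ball b.1 b.2) :=
        mul_le_mul_right ((measure_mono hset).trans_eq hmono.measure_iUnion) c
    _ = ⨆ n, c * μ (⋃ b ∈ T n, ball b.1 b.2) := ENNReal.mul_iSup ..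
    _ ≤ A ^ 2 * ∫⁻ x, f x ∂μ := iSup_le fun n => hμ.mul_measure_biUnion_ball_le
        (fun _ hb => hb.1) (fun _ hb => hb.2.1) fun _ hb => hb.2.2.le

theorem IsDoubling.exists_lintegral_fracMaximal_zero_rpow_le (hμ : IsDoubling μ A) {s : ℝ}
    (hs : 1 < s) : ∃ C : ℝ≥0, ∀ f : X → ℝ≥0∞, AEMeasurable f μ →
      ∫⁻ z, fracMaximal μ 0 f z ^ s ∂μ ≤ C * ∫⁻ x, f x ^ s ∂μ := by
  have hs1 : 0 < s - 1 := sub_pos.2 hs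
  have htop : 2 ^ s * (2 * A ^ 2) * geomConst (s - 1) * 2 ^ (s - 1) ≠ (⊤ : ℝ≥0∞) := by
    have := geomConst_ne_top hs1
    finiteness
  refine ⟨_, fun f hf => (lintegral_rpow_le_of_weakType hs
    (measurable_fracMaximal μ 0 f).aemeasurable hf fun c => ?_).trans_eq
      (by rw [ENNReal.coe_toNNReal htop])⟩
  have hset : {z | c < fracMaximal μ 0 f z} ⊆
      {z | c / 2 < fracMaximal μ 0 ({x | c / 2 < f x}.indicator f) z} := fun z hz => by
    by_contra! hle
    refine (lt_irrefl c (hz.trans_le ?_))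
    calc fracMaximal μ 0 f z ≤ _ := fracMaximal_zero_le_indicator_add f (c / 2) z
      _ ≤ c / 2 + c / 2 := add_le_add_left (not_lt.1 hle) _
      _ = c := ENNReal.add_halves c
  have hlevel : {x | c / 2 < f x} = {x | c < 2 * f x} := by
    ext x
    exact ENNReal.div_lt_iff (by simp) (by simp) |>.trans (by rw [mul_comm]; rfl)
  calc c * μ {z | c < fracMaximal μ 0 f z}
      ≤ 2 * (c / 2 * μ {z | c / 2 < fracMaximal μ 0 ({x | c / 2 < f x}.indicator f) z}) := by
        rw [← mul_assoc, ENNReal.mul_div_cancel two_ne_zero ENNReal.ofNat_ne_top]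
        exact mul_le_mul_right (measure_mono hset) c
    _ ≤ 2 * (A ^ 2 * ∫⁻ x, {x | c / 2 < f x}.indicator f x ∂μ) :=
        mul_le_mul_right (hμ.mul_measure_lt_fracMaximal_zero_le _ _) 2
    _ = 2 * A ^ 2 * ∫⁻ x in {x | c < 2 * f x}, f x ∂μ := by
        rw [← hlevel, lintegral_indicator₀ (nullMeasurableSet_lt aemeasurable_const hf), mul_assoc]

end FracMaximal

section DyadicRiesz

/-- The dyadic Riesz potential `∑_k 2 ^ (α k) ⨍_{B(z, 2 ^ k)} f` of order `α`, the discrete form of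
`∫ ρ(z, x) ^ α / μ (B(z, ρ(z, x))) f(x) dμ(x)`. -/
def dyadicRiesz (μ : Measure X) (α : ℝ) (f : X → ℝ≥0∞) (z : X) : ℝ≥0∞ :=
  ∑' k : ℤ, ((2 : ℝ≥0∞) ^ k) ^ α * ⨍⁻ x in ball z (2 ^ k), f x ∂μ

variable {μ : Measure X} {A : ℝ≥0} {α r : ℝ} {c : ℝ≥0∞} {f g h : X → ℝ≥0∞}

lemma lowerSemicontinuous_measure_ball (μ : Measure X) (r : ℝ) :
    LowerSemicontinuous fun z => μ (ball z r) := by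
  intro z c hc
  obtain ⟨v, hv, hvr, hlim⟩ := exists_seq_strictMono_tendsto r
  have hunion : ball z r = ⋃ n, ball z (v n) := by
    refine Subset.antisymm (fun y hy => ?_) (iUnion_subset fun n => ball_subset_ball (hvr n).le)
    obtain ⟨n, hn⟩ := (hlim.eventually_const_lt (mem_ball.1 hy)).exists
    exact mem_iUnion.2 ⟨n, hn⟩
  have hmono : Monotone fun n => ball z (v n) := fun m n hmn => ball_subset_ball (hv.monotone hmn)
  change c < μ (ball z r) at hc
  rw [hunion, hmono.measure_iUnion] at hc
  obtain ⟨n, hn⟩ := lt_iSup_iff.1 hc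
  filter_upwards [ball_mem_nhds z (sub_pos.2 (hvr n))] with y hy
  exact hn.trans_le (measure_mono (ball_subset_ball' (by linarith [mem_ball'.1 hy])))

lemma exists_dyadic_balls_cover_lt_average [SeparableSpace X] (μ : Measure X)
    (f : X → ℝ≥0∞) (c : ℝ≥0∞) (s : Finset ℤ) :
    ∃ u : Set (X × ℤ), u.Countable ∧ (u.PairwiseDisjoint fun b => ball b.1 ((2 : ℝ) ^ b.2)) ∧
      (∀ b ∈ u, ball b.1 (2 ^ b.2) ⊆ {z | c < fracMaximal μ 0 f z}) ∧
      ∀ k ∈ s, {z | c < ⨍⁻ x in ball z (2 ^ k), f x ∂μ} ⊆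
        ⋃ b : u, {z | k ≤ b.1.2 ∧ z ∈ ball b.1.1 (2 * 2 ^ b.1.2)} := by
  let T : Set (X × ℤ) := {a | a.2 ∈ s ∧ c < ⨍⁻ x in ball a.1 (2 ^ a.2), f x ∂μ}
  obtain ⟨n, hn⟩ := s.exists_le
  obtain ⟨u, huT, hu, hdisj, hcover⟩ :=
    exists_countable_disjoint_dyadic_balls (T := T) fun a ha => hn _ ha.1
  refine ⟨u, hu, hdisj, fun b hb z hz => ?_, fun k hk z hz => ?_⟩
  · refine lt_fracMaximal_iff.2 ⟨b.1, 2 ^ b.2, by positivity, hz, ?_⟩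
    rw [ENNReal.rpow_zero, one_mul]
    exact (huT hb).2
  · obtain ⟨b, hb, hmem⟩ := hcover (z, k) ⟨hk, hz⟩
    exact mem_iUnion.2 ⟨⟨b, hb⟩, hmem⟩

variable [OpensMeasurableSpace X]

lemma measurable_setLAverage_ball (μ : Measure X) (f : X → ℝ≥0∞) (r : ℝ) :
    Measurable fun z => ⨍⁻ x in ball z r, f x ∂μ := by
  simp_rw [setLAverage_eq, ← withDensity_apply f measurableSet_ball]
  exact (lowerSemicontinuous_measure_ball _ r).measurable.div
    (lowerSemicontinuous_measure_ball _ r).measurable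

lemma IsDoubling.rpow_mul_setLIntegral_ball_le (hμ : IsDoubling μ A) (hα : 0 ≤ α) (hr : 0 < r)
    (h : X → ℝ≥0∞) (z : X) :
    ENNReal.ofReal r ^ α * ∫⁻ x in ball z (2 * r), h x ∂μ ≤
      A * ∫⁻ x in ball z r, fracMaximal μ α h x ∂μ := by
  have hmax : ∀ y ∈ ball z r,
      ENNReal.ofReal r ^ α * ⨍⁻ x in ball z (2 * r), h x ∂μ ≤ fracMaximal μ α h y := fun y hy =>
    calc ENNReal.ofReal r ^ α * ⨍⁻ x in ball z (2 * r), h x ∂μ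
        ≤ ENNReal.ofReal (2 * r) ^ α * ⨍⁻ x in ball z (2 * r), h x ∂μ := by
          gcongr
          linarith
      _ ≤ fracMaximal μ α h y :=
          le_fracMaximal (by linarith) (ball_subset_ball (by linarith) hy)
  calc ENNReal.ofReal r ^ α * ∫⁻ x in ball z (2 * r), h x ∂μ
      = ENNReal.ofReal r ^ α * (μ (ball z (2 * r)) * ⨍⁻ x in ball z (2 * r), h x ∂μ) := by
        rw [measure_mul_setLAverage _ (hμ.measure_ball_ne_top _ _)]
    _ ≤ ENNReal.ofReal r ^ α * (A * μ (ball z r) * ⨍⁻ x in ball z (2 * r), h x ∂μ) := by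
        gcongr
        exact hμ.measure_ball_two_mul_le z r hr
    _ = A * ∫⁻ _ in ball z r, ENNReal.ofReal r ^ α * ⨍⁻ x in ball z (2 * r), h x ∂μ ∂μ := by
        rw [setLIntegral_const]
        ring
    _ ≤ A * ∫⁻ x in ball z r, fracMaximal μ α h x ∂μ :=
        mul_le_mul_right (setLIntegral_mono' measurableSet_ball hmax) _

variable [SeparableSpace X]

/-- A Carleson-type estimate: the points `(z, k)` of the upper half space at which the average of
`f` exceeds `c` lie in Carleson boxes over disjoint balls inside `{c < M f}`. -/
lemma IsDoubling.sum_setLIntegral_lt_average_le (hμ : IsDoubling μ A) (hα : 0 ≤ α)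
    (f h : X → ℝ≥0∞) (c : ℝ≥0∞) (s : Finset ℤ) :
    ∑ k ∈ s, ((2 : ℝ≥0∞) ^ k) ^ α * ∫⁻ z in {z | c < ⨍⁻ x in ball z (2 ^ k), f x ∂μ}, h z ∂μ ≤
      A * geomConst α * ∫⁻ z in {z | c < fracMaximal μ 0 f z}, fracMaximal μ α h z ∂μ := by
  obtain ⟨u, hu, hdisj, hsub, hcover⟩ := exists_dyadic_balls_cover_lt_average μ f c s
  have := hu.to_subtype
  have hbox (k : ℤ) (hk : k ∈ s) : ∫⁻ z in {z | c < ⨍⁻ x in ball z (2 ^ k), f x ∂μ}, h z ∂μ ≤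
      ∑' b : u, if k ≤ b.1.2 then ∫⁻ z in ball b.1.1 (2 * 2 ^ b.1.2), h z ∂μ else 0 := by
    refine (lintegral_mono_set (hcover k hk)).trans ((lintegral_iUnion_le _ _).trans_eq ?_)
    refine tsum_congr fun b => ?_
    split_ifs with hkb <;> simp [hkb, ball]
  calc ∑ k ∈ s, ((2 : ℝ≥0∞) ^ k) ^ α * ∫⁻ z in {z | c < ⨍⁻ x in ball z (2 ^ k), f x ∂μ}, h z ∂μ
      ≤ ∑' k : ℤ, ((2 : ℝ≥0∞) ^ k) ^ α *
          ∑' b : u, if k ≤ b.1.2 then ∫⁻ z in ball b.1.1 (2 * 2 ^ b.1.2), h z ∂μ else 0 :=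
        (Finset.sum_le_sum fun k hk => mul_le_mul_right (hbox k hk) _).trans (ENNReal.sum_le_tsum s)
    _ = ∑' b : u, geomConst α * (((2 : ℝ≥0∞) ^ b.1.2) ^ α *
          ∫⁻ z in ball b.1.1 (2 * 2 ^ b.1.2), h z ∂μ) := by
        simp_rw [← ENNReal.tsum_mul_left]
        rw [ENNReal.tsum_comm]
        refine tsum_congr fun b => ?_
        rw [← mul_assoc, ← tsum_two_zpow_rpow_of_le, ← ENNReal.tsum_mul_right]
        simp_rw [mul_ite, ite_mul, mul_zero, zero_mul]
    _ ≤ ∑' b : u, geomConst α * (A * ∫⁻ z in ball b.1.1 (2 ^ b.1.2), fracMaximal μ α h z ∂μ) := by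
        refine ENNReal.tsum_le_tsum fun b => mul_le_mul_right ?_ _
        rw [← ofReal_two_zpow]
        exact hμ.rpow_mul_setLIntegral_ball_le hα (zpow_pos two_pos _) h b.1.1
    _ = A * geomConst α * ∫⁻ z in ⋃ b ∈ u, ball b.1 (2 ^ b.2), fracMaximal μ α h z ∂μ := by
        rw [ENNReal.tsum_mul_left, ENNReal.tsum_mul_left,
          lintegral_biUnion hu (fun _ _ => measurableSet_ball) hdisj]
        ring
    _ ≤ A * geomConst α * ∫⁻ z in {z | c < fracMaximal μ 0 f z}, fracMaximal μ α h z ∂μ :=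
        mul_le_mul_right (lintegral_mono_set (iUnion₂_subset hsub)) _

lemma IsDoubling.sum_lintegral_mul_average_le (hμ : IsDoubling μ A) (hα : 0 ≤ α)
    (hh : AEMeasurable h μ) (f : X → ℝ≥0∞) (s : Finset ℤ) :
    ∑ k ∈ s, ((2 : ℝ≥0∞) ^ k) ^ α * ∫⁻ z, (⨍⁻ x in ball z (2 ^ k), f x ∂μ) * h z ∂μ ≤
      2 * A * geomConst α * geomConst 1 * ∫⁻ z, fracMaximal μ 0 f z * fracMaximal μ α h z ∂μ := by
  have hf (k : ℤ) := measurable_setLAverage_ball μ f (2 ^ k)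
  have hM := measurable_fracMaximal μ 0 f
  have hM' := measurable_fracMaximal μ α h
  have hle (x y : ℝ≥0∞) : x * y ≤ 2 * (dyadicLayer 1 x * y) := by
    rw [← mul_assoc]
    exact mul_le_mul_left (by simpa using rpow_le_dyadicLayer one_pos x) y
  have hge (x y : ℝ≥0∞) : dyadicLayer 1 x * y ≤ geomConst 1 * (x * y) := by
    rw [← mul_assoc]
    exact mul_le_mul_left (by simpa using dyadicLayer_le one_pos x) y
  calc ∑ k ∈ s, ((2 : ℝ≥0∞) ^ k) ^ α * ∫⁻ z, (⨍⁻ x in ball z (2 ^ k), f x ∂μ) * h z ∂μ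
      ≤ ∑ k ∈ s, ((2 : ℝ≥0∞) ^ k) ^ α *
          (2 * ∫⁻ z, dyadicLayer 1 (⨍⁻ x in ball z (2 ^ k), f x ∂μ) * h z ∂μ) := by
        refine Finset.sum_le_sum fun k _ => mul_le_mul_right ?_ _
        rw [← lintegral_const_mul' _ _ ENNReal.ofNat_ne_top]
        exact lintegral_mono fun z => hle _ _
    _ = 2 * ∑' j : ℤ, (2 : ℝ≥0∞) ^ j * ∑ k ∈ s, ((2 : ℝ≥0∞) ^ k) ^ α *
          ∫⁻ z in {z | (2 : ℝ≥0∞) ^ j < ⨍⁻ x in ball z (2 ^ k), f x ∂μ}, h z ∂μ := by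
        simp_rw [lintegral_dyadicLayer_mul 1 (hf _).aemeasurable hh, ENNReal.rpow_one,
          Finset.mul_sum]
        rw [Summable.tsum_finsetSum fun _ _ => ENNReal.summable, Finset.mul_sum]
        refine Finset.sum_congr rfl fun k _ => ?_
        rw [← ENNReal.tsum_mul_left, ← ENNReal.tsum_mul_left, ← ENNReal.tsum_mul_left]
        exact tsum_congr fun j => by ring
    _ ≤ 2 * ∑' j : ℤ, (2 : ℝ≥0∞) ^ j * (A * geomConst α *
          ∫⁻ z in {z | (2 : ℝ≥0∞) ^ j < fracMaximal μ 0 f z}, fracMaximal μ α h z ∂μ) := by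
        gcongr with j
        exact hμ.sum_setLIntegral_lt_average_le hα f h _ s
    _ = 2 * A * geomConst α * ∫⁻ z, dyadicLayer 1 (fracMaximal μ 0 f z) *
          fracMaximal μ α h z ∂μ := by
        simp_rw [lintegral_dyadicLayer_mul 1 hM.aemeasurable hM'.aemeasurable, ENNReal.rpow_one,
          mul_assoc, ← ENNReal.tsum_mul_left]
        exact tsum_congr fun j => by ring
    _ ≤ 2 * A * geomConst α * ∫⁻ z, geomConst 1 *
          (fracMaximal μ 0 f z * fracMaximal μ α h z) ∂μ :=
        mul_le_mul_right (lintegral_mono fun z => hge _ _) _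
    _ = 2 * A * geomConst α * geomConst 1 *
          ∫⁻ z, fracMaximal μ 0 f z * fracMaximal μ α h z ∂μ := by
        rw [lintegral_const_mul' _ _ (geomConst_ne_top one_pos), mul_assoc (2 * A * geomConst α)]

theorem IsDoubling.lintegral_mul_dyadicRiesz_le (hμ : IsDoubling μ A) (hα : 0 ≤ α)
    (hh : AEMeasurable h μ) (f : X → ℝ≥0∞) :
    ∫⁻ z, h z * dyadicRiesz μ α f z ∂μ ≤
      2 * A * geomConst α * geomConst 1 * ∫⁻ z, fracMaximal μ 0 f z * fracMaximal μ α h z ∂μ := by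
  have hf (k : ℤ) := measurable_setLAverage_ball μ f (2 ^ k)
  have hterm (k : ℤ) : ∫⁻ z, h z * (((2 : ℝ≥0∞) ^ k) ^ α * ⨍⁻ x in ball z (2 ^ k), f x ∂μ) ∂μ =
      ((2 : ℝ≥0∞) ^ k) ^ α * ∫⁻ z, (⨍⁻ x in ball z (2 ^ k), f x ∂μ) * h z ∂μ := by
    rw [← lintegral_const_mul'' _ ((hf k).aemeasurable.fun_mul hh)]
    exact lintegral_congr fun z => by ring
  simp_rw [dyadicRiesz, ← ENNReal.tsum_mul_left]
  rw [lintegral_tsum fun k => hh.fun_mul ((hf k).const_mul _).aemeasurable,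
    ENNReal.tsum_eq_iSup_sum]
  refine iSup_le fun s => ?_
  simp_rw [hterm]
  exact hμ.sum_lintegral_mul_average_le hα hh f s

end DyadicRiesz

section Morrey

/-- The Morrey norm `sup r ^ α (⨍_B g ^ q) ^ (1 / q)` over all balls `B`, with `r` the radius of
`B`. -/
def ballMorreyNorm (μ : Measure X) (q α : ℝ) (g : X → ℝ≥0∞) : ℝ≥0∞ :=
  ⨆ (r : ℝ) (_ : 0 < r) (z : X), ENNReal.ofReal r ^ α * (⨍⁻ x in ball z r, g x ^ q ∂μ) ^ (1 / q)

variable {μ : Measure X} {A : ℝ≥0} {p q α : ℝ} {b g : X → ℝ≥0∞}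

lemma fracMaximal_mul_le {q' : ℝ} (hq : q.HolderConjugate q') (hb : AEMeasurable b μ)
    (hg : AEMeasurable g μ) (α : ℝ) (z : X) :
    fracMaximal μ α (fun x => b x * g x) z ≤
      ballMorreyNorm μ q α b * fracMaximal μ 0 (fun x => g x ^ q') z ^ (1 / q') := by
  refine fracMaximal_le_iff.2 fun w r hr hz => ?_
  have hae {f : X → ℝ≥0∞} (hf : AEMeasurable f μ) :
      AEMeasurable f (((μ.restrict (ball w r)) univ)⁻¹ • μ.restrict (ball w r)) :=
    hf.restrict.smul_measure _
  calc ENNReal.ofReal r ^ α * ⨍⁻ x in ball w r, b x * g x ∂μ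
      ≤ ENNReal.ofReal r ^ α * ((⨍⁻ x in ball w r, b x ^ q ∂μ) ^ (1 / q) *
          (⨍⁻ x in ball w r, g x ^ q' ∂μ) ^ (1 / q')) :=
        mul_le_mul_right (ENNReal.lintegral_mul_le_Lp_mul_Lq _ hq (hae hb) (hae hg)) _
    _ = ENNReal.ofReal r ^ α * (⨍⁻ x in ball w r, b x ^ q ∂μ) ^ (1 / q) *
          (⨍⁻ x in ball w r, g x ^ q' ∂μ) ^ (1 / q') := (mul_assoc ..).symm
    _ ≤ ballMorreyNorm μ q α b * fracMaximal μ 0 (fun x => g x ^ q') z ^ (1 / q') := by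
        gcongr
        · exact le_iSup₂_of_le r hr (le_iSup_of_le w le_rfl)
        · exact one_div_nonneg.2 hq.symm.nonneg
        · simpa using le_fracMaximal (μ := μ) (α := 0) (f := fun x => g x ^ q') hr hz

variable [OpensMeasurableSpace X] [SeparableSpace X]

lemma one_lt_div_of_holderConjugate {p' q' : ℝ} (hp : p.HolderConjugate p')
    (hq : q.HolderConjugate q') (hpq : p < q) : 1 < p' / q' := by
  rw [one_lt_div hq.symm.pos, hp.conjugate_eq, hq.conjugate_eq,
    div_lt_div_iff₀ hq.sub_one_pos hp.sub_one_pos]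
  linarith

lemma IsDoubling.lintegral_mul_mul_dyadicRiesz_le (hμ : IsDoubling μ A) (hα : 0 ≤ α)
    {p' q' : ℝ} (hp : p.HolderConjugate p') (hq : q.HolderConjugate q') (hb : AEMeasurable b μ)
    (hg : AEMeasurable g μ) (f : X → ℝ≥0∞) :
    ∫⁻ z, g z * (b z * dyadicRiesz μ α f z) ∂μ ≤
      2 * A * geomConst α * geomConst 1 * ballMorreyNorm μ q α b *
        ((∫⁻ z, fracMaximal μ 0 f z ^ p ∂μ) ^ (1 / p) *
          (∫⁻ z, fracMaximal μ 0 (fun x => g x ^ q') z ^ (p' / q') ∂μ) ^ (1 / p')) := by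
  set N := ballMorreyNorm μ q α b
  let G (z : X) : ℝ≥0∞ := fracMaximal μ 0 (fun x => g x ^ q') z ^ (1 / q')
  have hM := measurable_fracMaximal μ 0 f
  have hG : Measurable G := (measurable_fracMaximal ..).pow_const _
  have hGp (z : X) : G z ^ p' = fracMaximal μ 0 (fun x => g x ^ q') z ^ (p' / q') := by
    rw [← ENNReal.rpow_mul, one_div_mul_eq_div]
  calc ∫⁻ z, g z * (b z * dyadicRiesz μ α f z) ∂μ
      = ∫⁻ z, b z * g z * dyadicRiesz μ α f z ∂μ := lintegral_congr fun z => by ring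
    _ ≤ 2 * A * geomConst α * geomConst 1 *
          ∫⁻ z, fracMaximal μ 0 f z * fracMaximal μ α (fun x => b x * g x) z ∂μ :=
        hμ.lintegral_mul_dyadicRiesz_le hα (hb.mul hg) f
    _ ≤ 2 * A * geomConst α * geomConst 1 * ∫⁻ z, N * (fracMaximal μ 0 f z * G z) ∂μ := by
        refine mul_le_mul_right (lintegral_mono fun z => ?_) _
        exact (mul_le_mul_right (fracMaximal_mul_le hq hb hg α z) _).trans_eq (mul_left_comm ..)
    _ = 2 * A * geomConst α * geomConst 1 * N * ∫⁻ z, fracMaximal μ 0 f z * G z ∂μ := by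
        rw [lintegral_const_mul _ (hM.fun_mul hG), mul_assoc _ N]
    _ ≤ 2 * A * geomConst α * geomConst 1 * N *
          ((∫⁻ z, fracMaximal μ 0 f z ^ p ∂μ) ^ (1 / p) * (∫⁻ z, G z ^ p' ∂μ) ^ (1 / p')) :=
        mul_le_mul_right (ENNReal.lintegral_mul_le_Lp_mul_Lq _ hp hM.aemeasurable
          hG.aemeasurable) _
    _ = _ := by simp_rw [hGp]

/-- Adams' trace inequality for a Morrey weight. -/
theorem IsDoubling.exists_lintegral_mul_dyadicRiesz_rpow_le [SigmaFinite μ] (hμ : IsDoubling μ A)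
    (hα : 0 < α) (hp : 1 < p) (hpq : p < q) :
    ∃ C : ℝ≥0, ∀ b f : X → ℝ≥0∞, AEMeasurable b μ → AEMeasurable f μ →
      ∫⁻ z, (b z * dyadicRiesz μ α f z) ^ p ∂μ ≤
        C * ballMorreyNorm μ q α b ^ p * ∫⁻ z, f z ^ p ∂μ := by
  have hpp := Real.HolderConjugate.conjExponent hp
  have hqq := Real.HolderConjugate.conjExponent (hp.trans hpq)
  set p' := p.conjExponent
  set q' := q.conjExponent
  have hp0 : 0 ≤ 1 / p := one_div_nonneg.2 hpp.nonneg
  have hp'0 : 0 ≤ 1 / p' := one_div_nonneg.2 hpp.symm.nonneg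
  obtain ⟨C₁, hC₁⟩ := hμ.exists_lintegral_fracMaximal_zero_rpow_le hp
  obtain ⟨C₂, hC₂⟩ := hμ.exists_lintegral_fracMaximal_zero_rpow_le
    (one_lt_div_of_holderConjugate hpp hqq hpq)
  set K : ℝ≥0∞ := 2 * A * geomConst α * geomConst 1 * (C₁ ^ (1 / p) * C₂ ^ (1 / p')) with hK
  have hKp : K ^ p ≠ ⊤ := by
    have := geomConst_ne_top hα
    have := geomConst_ne_top one_pos
    have := hpp.nonneg
    finiteness
  refine ⟨(K ^ p).toNNReal, fun b f hb hf => ?_⟩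
  set N := ballMorreyNorm μ q α b
  have hpair (g : X → ℝ≥0∞) (hg : Measurable g) : ∫⁻ z, g z * (b z * dyadicRiesz μ α f z) ∂μ ≤
      K * N * (∫⁻ z, f z ^ p ∂μ) ^ (1 / p) * (∫⁻ z, g z ^ p' ∂μ) ^ (1 / p') := by
    have hg' : ∫⁻ z, (g z ^ q') ^ (p' / q') ∂μ = ∫⁻ z, g z ^ p' ∂μ := by
      simp_rw [← ENNReal.rpow_mul, mul_div_cancel₀ _ hqq.symm.ne_zero]
    refine (hμ.lintegral_mul_mul_dyadicRiesz_le hα.le hpp hqq hb hg.aemeasurable f).trans ?_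
    calc _ ≤ 2 * A * geomConst α * geomConst 1 * N * ((C₁ * ∫⁻ z, f z ^ p ∂μ) ^ (1 / p) *
          (C₂ * ∫⁻ z, (g z ^ q') ^ (p' / q') ∂μ) ^ (1 / p')) := by
          gcongr
          · exact hC₁ f hf
          · exact hC₂ _ (hg.pow_const q').aemeasurable
      _ = _ := by
          rw [hg', ENNReal.mul_rpow_of_nonneg _ _ hp0, ENNReal.mul_rpow_of_nonneg _ _ hp'0, hK]
          ring
  refine (lintegral_rpow_le_of_forall_lintegral_mul_le hpp hpair).trans_eq ?_
  rw [ENNReal.coe_toNNReal hKp, ENNReal.mul_rpow_of_nonneg _ _ hpp.nonneg,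
    ENNReal.mul_rpow_of_nonneg _ _ hpp.nonneg, ← ENNReal.rpow_mul,
    one_div_mul_cancel hpp.ne_zero, ENNReal.rpow_one]

end Morrey

end Doubling

/-! ### The parabolic metric -/

variable {d : ℕ}

/-- The space `ℝ^{d+1}` with Lebesgue measure, metrized by the parabolic distance
`max (√|t - s|) |x - y|`, for which the dilations `(t, x) ↦ (ε ^ 2 t, ε x)` are homotheties. It is
a type synonym because `Spacetime d` already carries the product metric. -/
def Parabolic (d : ℕ) : Type := Spacetime d

instance : MeasureSpace (Parabolic d) := inferInstanceAs (MeasureSpace (Spacetime d))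

instance : SigmaFinite (volume : Measure (Parabolic d)) :=
  inferInstanceAs (SigmaFinite (volume : Measure (Spacetime d)))

instance : (volume : Measure (Spacetime d)).IsAddHaarMeasure :=
  Measure.prod.instIsAddHaarMeasure volume volume

lemma sqrt_add_le_add_sqrt {a b : ℝ} (ha : 0 ≤ a) (hb : 0 ≤ b) : √(a + b) ≤ √a + √b := by
  refine Real.sqrt_le_iff.2 ⟨by positivity, ?_⟩
  rw [add_sq, Real.sq_sqrt ha, Real.sq_sqrt hb]
  linarith [mul_nonneg (Real.sqrt_nonneg a) (Real.sqrt_nonneg b)]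

instance : PseudoMetricSpace (Parabolic d) where
  dist z w := max √(dist z.1 w.1) (dist z.2 w.2)
  dist_self z := by simp
  dist_comm z w := by simp only [dist_comm]
  dist_triangle x y z := max_le
    ((Real.sqrt_le_sqrt (dist_triangle x.1 y.1 z.1)).trans
      ((sqrt_add_le_add_sqrt dist_nonneg dist_nonneg).trans
        (add_le_add (le_max_left _ _) (le_max_left _ _))))
    ((dist_triangle x.2 y.2 z.2).trans (add_le_add (le_max_right _ _) (le_max_right _ _)))

lemma Parabolic.dist_def (z w : Parabolic d) :
    dist z w = max √(dist z.1 w.1) (dist z.2 w.2) := rfl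

lemma Parabolic.mem_ball {z w : Parabolic d} {r : ℝ} (hr : 0 < r) :
    w ∈ ball z r ↔ dist w.1 z.1 < r ^ 2 ∧ dist w.2 z.2 < r := by
  rw [Metric.mem_ball, Parabolic.dist_def, max_lt_iff, Real.sqrt_lt' hr]

lemma Parabolic.ball_eq_prod (z : Parabolic d) {r : ℝ} (hr : 0 < r) :
    ball z r = (ball z.1 (r ^ 2) ×ˢ ball z.2 r : Set (Spacetime d)) :=
  Set.ext fun _ => Parabolic.mem_ball hr

/-- The identity map from `ℝ^{d+1}` with the product metric to `ℝ^{d+1}` with the parabolic one. -/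
def toParabolic (z : Spacetime d) : Parabolic d := z

lemma continuous_toParabolic : Continuous (toParabolic (d := d)) := by
  refine continuous_iff_continuousAt.2 fun z => tendsto_iff_dist_tendsto_zero.2 ?_
  have h : Continuous fun w : Spacetime d => max √(dist w.1 z.1) (dist w.2 z.2) := by fun_prop
  change Tendsto (fun w : Spacetime d => max √(dist w.1 z.1) (dist w.2 z.2)) _ _
  simpa using h.tendsto z

instance : OpensMeasurableSpace (Parabolic d) :=
  ⟨MeasurableSpace.generateFrom_le fun _ (hs : IsOpen _) =>
    ((hs.preimage continuous_toParabolic).measurableSet :)⟩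

instance : SeparableSpace (Parabolic d) :=
  Function.Surjective.denseRange (f := toParabolic) (fun z => ⟨z, rfl⟩)
    |>.separableSpace continuous_toParabolic

lemma volume_euclidean_ball (x : EuclideanSpace ℝ (Fin d)) {r : ℝ} (hr : 0 < r) :
    volume (ball x r) =
      ENNReal.ofReal r ^ d * volume (ball (0 : EuclideanSpace ℝ (Fin d)) 1) := by
  rw [Measure.addHaar_ball_of_pos _ _ hr, finrank_euclideanSpace_fin, ENNReal.ofReal_pow hr.le]

lemma Parabolic.volume_ball (z : Parabolic d) {r : ℝ} (hr : 0 < r) :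
    volume (ball z r) = ENNReal.ofReal r ^ (d + 2) *
      (2 * volume (ball (0 : EuclideanSpace ℝ (Fin d)) 1)) := by
  have h : volume (ball z r) = (volume : Measure (Spacetime d)) (ball z.1 (r ^ 2) ×ˢ ball z.2 r) :=
    congrArg (volume : Measure (Spacetime d)) (Parabolic.ball_eq_prod z hr)
  rw [h, Measure.volume_eq_prod, Measure.prod_prod, Real.volume_ball, volume_euclidean_ball _ hr,
    ENNReal.ofReal_mul zero_le_two, ENNReal.ofReal_pow hr.le, ENNReal.ofReal_ofNat]
  ring

lemma volume_paraCylinder (z : Spacetime d) {r : ℝ} (hr : 0 < r) :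
    volume (paraCylinder r z) = ENNReal.ofReal r ^ (d + 2) *
      volume (ball (0 : EuclideanSpace ℝ (Fin d)) 1) := by
  have h : paraCylinder r z = Ico z.1 (z.1 + r ^ 2) ×ˢ ball z.2 r := by
    ext w
    simp only [paraCylinder, mem_ofPred_eq, mem_prod, mem_Ico, Metric.mem_ball, dist_eq_norm,
      norm_sub_rev z.2]
    tauto
  rw [h, Measure.volume_eq_prod, Measure.prod_prod, Real.volume_Ico, volume_euclidean_ball _ hr,
    add_sub_cancel_left, ENNReal.ofReal_pow hr.le]
  ring

lemma Parabolic.isDoubling_volume (d : ℕ) :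
    IsDoubling (volume : Measure (Parabolic d)) (2 ^ (d + 2)) where
  measure_ball_ne_zero z r hr := by
    rw [Parabolic.volume_ball z hr]
    have := (measure_ball_pos volume (0 : EuclideanSpace ℝ (Fin d)) one_pos).ne'
    have := (ENNReal.ofReal_pos.2 hr).ne'
    positivity
  measure_ball_ne_top z r := by
    rcases le_or_gt r 0 with hr | hr
    · simp [ball_eq_empty.2 hr]
    rw [Parabolic.volume_ball z hr]
    have := (measure_ball_lt_top (μ := volume) (x := (0 : EuclideanSpace ℝ (Fin d))) (r := 1)).ne
    finiteness
  measure_ball_two_mul_le z r hr := by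
    rw [Parabolic.volume_ball z hr, Parabolic.volume_ball z (by positivity),
      ENNReal.ofReal_mul zero_le_two, ENNReal.ofReal_ofNat, mul_pow, mul_assoc]
    push_cast
    rfl

lemma Parabolic.ball_subset_paraCylinder (z : Parabolic d) {r : ℝ} (hr : 0 < r) :
    ball z r ⊆ paraCylinder (2 * r) (z.1 - r ^ 2, z.2) := by
  intro w hw
  obtain ⟨ht, hx⟩ := (Parabolic.mem_ball hr).1 hw
  rw [Real.dist_eq, abs_lt] at ht
  rw [dist_comm, dist_eq_norm] at hx
  exact ⟨by linarith, by linarith [ht.1], by dsimp only; nlinarith [ht.2]⟩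

lemma ballMorreyNorm_le_morreyNorm {m : ℕ} {q α : ℝ} (hq : 0 < q) (hα : 0 ≤ α)
    (b : Spacetime d → EuclideanSpace ℝ (Fin m)) :
    ballMorreyNorm (X := Parabolic d) volume q α (fun z => ‖b z‖ₑ) ≤
      (2 ^ (d + 2)) ^ (1 / q) * morreyNorm q α b := by
  refine iSup₂_le fun r hr => iSup_le fun z => ?_
  set z' : Spacetime d := (z.1 - r ^ 2, z.2)
  have hvol : volume (paraCylinder (2 * r) z') ≤ 2 ^ (d + 2) * volume (ball z r) := by
    rw [Parabolic.volume_ball z hr, volume_paraCylinder z' (by positivity),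
      ENNReal.ofReal_mul zero_le_two, ENNReal.ofReal_ofNat, mul_pow, mul_assoc]
    gcongr
    exact le_mul_of_one_le_left' one_le_two
  have hfin : volume (paraCylinder (2 * r) z') ≠ ⊤ :=
    ne_top_of_le_ne_top
      (ENNReal.mul_ne_top (by finiteness) ((Parabolic.isDoubling_volume d).measure_ball_ne_top z r))
      hvol
  calc ENNReal.ofReal r ^ α * (⨍⁻ w in ball z r, ‖b w‖ₑ ^ q ∂volume) ^ (1 / q)
      ≤ ENNReal.ofReal ((2 * r) ^ α) *
          (2 ^ (d + 2) * ⨍⁻ w in paraCylinder (2 * r) z', ‖b w‖ₑ ^ q ∂volume) ^ (1 / q) := by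
        gcongr ?_ * ?_ ^ (1 / q)
        · rw [ENNReal.ofReal_rpow_of_nonneg hr.le hα]
          gcongr
          linarith
        · exact setLAverage_le_of_subset (μ := (volume : Measure (Spacetime d)))
            (Parabolic.ball_subset_paraCylinder z hr) hfin hvol _
    _ = (2 ^ (d + 2)) ^ (1 / q) * (ENNReal.ofReal ((2 * r) ^ α) *
          (⨍⁻ w in paraCylinder (2 * r) z', ‖b w‖ₑ ^ q ∂volume) ^ (1 / q)) := by
        rw [ENNReal.mul_rpow_of_nonneg _ _ (by positivity)]
        ring
    _ ≤ (2 ^ (d + 2)) ^ (1 / q) * morreyNorm q α b := by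
        gcongr
        exact le_iSup₂_of_le (2 * r) (by positivity) (le_iSup_of_le z' le_rfl)

/-! ### The potential is dominated by a dyadic Riesz potential -/

lemma max_sqrt_div_sqrt_le {s : ℝ} (hs : 0 < s) (r : ℝ) :
    max r √s / √s ≤ 1 + r ^ 2 / s := by
  have hσ : 0 < √s := Real.sqrt_pos.2 hs
  have hdiv : r ^ 2 / s = (r / √s) ^ 2 := by rw [div_pow, Real.sq_sqrt hs.le]
  rw [← max_div_div_right hσ.le, div_self hσ.ne', hdiv]
  exact max_le (by nlinarith [sq_nonneg (r / √s - 1), sq_nonneg (r / √s)])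
    (le_add_of_nonneg_right (sq_nonneg _))

lemma kernel_mul_max_sqrt_pow_le (d : ℕ) (α : ℝ) {s : ℝ} (hs : 0 < s) (r : ℝ) :
    kernel d α s r * max r √s ^ (d + 2) ≤
      ⌈(d : ℝ) + 2 - α⌉₊.factorial * Real.exp 1 * max r √s ^ α := by
  set γ : ℝ := (d : ℝ) + 2 - α with hγ
  have hσ : 0 < √s := Real.sqrt_pos.2 hs
  set m := max r √s
  have hm0 : 0 < m := lt_max_of_lt_right hσ
  have hratio : 1 ≤ m / √s := (one_le_div hσ).2 (le_max_right _ _)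
  have hpow : s ^ (γ / 2) = √s ^ γ := by
    rw [Real.sqrt_eq_rpow, ← Real.rpow_mul hs.le]
    ring_nf
  have hexp : (m / √s) ^ γ ≤ ⌈γ⌉₊.factorial * Real.exp (1 + r ^ 2 / s) := by
    calc (m / √s) ^ γ ≤ (m / √s) ^ ⌈γ⌉₊ := by
          rw [← Real.rpow_natCast]
          exact Real.rpow_le_rpow_of_exponent_le hratio (Nat.le_ceil γ)
      _ ≤ (1 + r ^ 2 / s) ^ ⌈γ⌉₊ := by
          gcongr
          exact max_sqrt_div_sqrt_le hs r
      _ ≤ ⌈γ⌉₊.factorial * Real.exp (1 + r ^ 2 / s) := by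
          rw [← div_le_iff₀' (by exact_mod_cast Nat.factorial_pos _)]
          exact Real.pow_div_factorial_le_exp (x := 1 + r ^ 2 / s) (by positivity) _
  calc kernel d α s r * m ^ (d + 2)
      = (m / √s) ^ γ * Real.exp (-r ^ 2 / s) * m ^ α := by
        have hsplit : m ^ (d + 2) = m ^ γ * m ^ α := by
          rw [← Real.rpow_add hm0, ← Real.rpow_natCast, hγ]
          push_cast
          ring_nf
        rw [kernel, if_pos hs, ← hγ, hpow, hsplit, Real.div_rpow hm0.le hσ.le]
        ring
    _ ≤ ⌈γ⌉₊.factorial * Real.exp (1 + r ^ 2 / s) * Real.exp (-r ^ 2 / s) * m ^ α := by gcongr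
    _ = ⌈γ⌉₊.factorial * Real.exp 1 * m ^ α := by
        rw [mul_assoc (_ : ℝ) (Real.exp _) (Real.exp _), ← Real.exp_add]
        ring_nf

lemma exists_kernel_mul_zpow_le (d : ℕ) {α : ℝ} (hα : 0 ≤ α) :
    ∃ C : ℝ≥0, ∀ w : Spacetime d, 0 < w.1 →
      ∃ k : ℤ, toParabolic w ∈ ball (toParabolic (0 : Spacetime d)) (2 ^ k) ∧
        kernel d α w.1 ‖w.2‖ * (2 ^ k) ^ (d + 2) ≤ C * (2 ^ k) ^ α := by
  set c : ℝ := ⌈(d : ℝ) + 2 - α⌉₊.factorial * Real.exp 1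
  refine ⟨(c * 2 ^ (d + 2)).toNNReal, fun w hw => ?_⟩
  rw [Real.coe_toNNReal _ (by positivity)]
  set m := max ‖w.2‖ √w.1 with hm
  have hm0 : 0 < m := lt_max_of_lt_right (Real.sqrt_pos.2 hw)
  obtain ⟨n, hn, hn'⟩ := exists_mem_Ico_zpow hm0 (one_lt_two (α := ℝ))
  set R : ℝ := 2 ^ (n + 1) with hR
  have hRm : R ≤ 2 * m := by
    rw [hR, zpow_add_one₀ two_ne_zero, mul_comm]
    gcongr
  have hk0 : 0 ≤ kernel d α w.1 ‖w.2‖ := by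
    rw [kernel, if_pos hw]
    positivity
  refine ⟨n + 1, ?_, ?_⟩
  · rw [Metric.mem_ball, Parabolic.dist_def]
    simpa [toParabolic, abs_of_pos hw, hm, max_comm] using hn'
  calc kernel d α w.1 ‖w.2‖ * R ^ (d + 2)
      ≤ kernel d α w.1 ‖w.2‖ * (2 * m) ^ (d + 2) := by gcongr
    _ = 2 ^ (d + 2) * (kernel d α w.1 ‖w.2‖ * m ^ (d + 2)) := by ring
    _ ≤ 2 ^ (d + 2) * (c * m ^ α) := by
      gcongr 2 ^ (d + 2) * ?_
      exact kernel_mul_max_sqrt_pow_le d α hw _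
    _ ≤ 2 ^ (d + 2) * (c * R ^ α) := by gcongr
    _ = c * 2 ^ (d + 2) * R ^ α := by ring

lemma exists_ofReal_kernel_le (d : ℕ) {α : ℝ} (hα : 0 ≤ α) :
    ∃ C : ℝ≥0, ∀ w : Spacetime d, 0 < w.1 →
      ∃ k : ℤ, toParabolic w ∈ ball (toParabolic (0 : Spacetime d)) (2 ^ k) ∧
        ENNReal.ofReal (kernel d α w.1 ‖w.2‖) ≤
          C * (((2 : ℝ≥0∞) ^ k) ^ α / volume (ball (toParabolic (0 : Spacetime d)) (2 ^ k))) := by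
  obtain ⟨C, hC⟩ := exists_kernel_mul_zpow_le d hα
  set V : ℝ≥0∞ := 2 * volume (ball (0 : EuclideanSpace ℝ (Fin d)) 1) with hVdef
  have hVtop : V ≠ ⊤ := by
    have := (measure_ball_lt_top (μ := volume) (x := (0 : EuclideanSpace ℝ (Fin d))) (r := 1)).ne
    finiteness
  refine ⟨C * V.toNNReal, fun w hw => ?_⟩
  obtain ⟨k, hwk, hk⟩ := hC w hw
  have hR : (0 : ℝ) < 2 ^ k := by positivity
  refine ⟨k, hwk, ?_⟩
  rw [← mul_div_assoc, ENNReal.le_div_iff_mul_le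
      (.inl ((Parabolic.isDoubling_volume d).measure_ball_ne_zero _ _ hR))
      (.inl ((Parabolic.isDoubling_volume d).measure_ball_ne_top _ _)),
    Parabolic.volume_ball _ hR, ← hVdef]
  push_cast
  rw [ENNReal.coe_toNNReal hVtop, ← mul_assoc, mul_right_comm _ V]
  refine mul_le_mul_left ?_ _
  rw [← ofReal_two_zpow, ENNReal.ofReal_rpow_of_pos hR, ← ENNReal.ofReal_pow hR.le,
    ← ENNReal.ofReal_mul' (by positivity), ← ENNReal.ofReal_coe_nnreal,
    ← ENNReal.ofReal_mul C.coe_nonneg]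
  exact ENNReal.ofReal_le_ofReal hk

lemma setLIntegral_ball_add_left (f : Spacetime d → ℝ≥0∞) (z : Spacetime d) (r : ℝ) :
    ∫⁻ w in toParabolic ⁻¹' ball (toParabolic 0) r, f (z + w) =
      ∫⁻ x in toParabolic ⁻¹' ball (toParabolic z) r, f x := by
  have hball : toParabolic ⁻¹' ball (toParabolic 0) r =
      (z + ·) ⁻¹' (toParabolic ⁻¹' ball (toParabolic z) r) := by
    ext w
    simp only [mem_preimage, Metric.mem_ball, Parabolic.dist_def]
    simp [toParabolic]
  rw [hball]
  exact (measurePreserving_add_left volume z).setLIntegral_comp_preimage_emb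
    (measurableEmbedding_addLeft z) f _

lemma exists_potential_le_dyadicRiesz (d : ℕ) {α : ℝ} (hα : 0 ≤ α) :
    ∃ C : ℝ≥0, ∀ f : Spacetime d → ℝ≥0∞, AEMeasurable f volume → ∀ z,
      potential α f z ≤ C * dyadicRiesz (volume : Measure (Parabolic d)) α f (toParabolic z) := by
  obtain ⟨C, hC⟩ := exists_ofReal_kernel_le d hα
  let B : ℤ → Set (Spacetime d) := fun k => toParabolic ⁻¹' ball (toParabolic 0) (2 ^ k)
  have hB : ∀ k, MeasurableSet (B k) := fun k =>
    (isOpen_ball.preimage continuous_toParabolic).measurableSet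
  refine ⟨C, fun f hf z => ?_⟩
  have hfz : AEMeasurable (fun w => f (z + w)) volume :=
    hf.comp_quasiMeasurePreserving (measurePreserving_add_left volume z).quasiMeasurePreserving
  calc potential α f z
      ≤ ∫⁻ w, C * ∑' k : ℤ,
          (B k).indicator (fun w => ((2 : ℝ≥0∞) ^ k) ^ α / volume (B k) * f (z + w)) w := by
        refine lintegral_mono fun w => ?_
        rcases le_or_gt w.1 0 with hw | hw
        · simp [kernel, hw.not_gt]
        obtain ⟨k, hwk, hk⟩ := hC w hw
        refine (mul_le_mul_left hk _).trans ?_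
        rw [mul_assoc]
        refine mul_le_mul_right (le_trans ?_ (ENNReal.le_tsum k)) _
        rw [indicator_of_mem (show w ∈ B k from hwk)]
        rfl
    _ = C * ∑' k : ℤ, ((2 : ℝ≥0∞) ^ k) ^ α / volume (B k) * ∫⁻ w in B k, f (z + w) := by
        rw [lintegral_const_mul' _ _ ENNReal.coe_ne_top,
          lintegral_tsum fun k => (hfz.const_mul _).indicator (hB k)]
        congr 2 with k
        rw [lintegral_indicator (hB k), lintegral_const_mul'' _ hfz.restrict]
    _ = C * dyadicRiesz (volume : Measure (Parabolic d)) α f (toParabolic z) := by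
        congr 2 with k
        have hvol : volume (B k) = volume (ball (toParabolic z) (2 ^ k)) := by
          rw [Parabolic.volume_ball _ (by positivity),
            ← Parabolic.volume_ball (toParabolic 0) (by positivity)]
          rfl
        rw [setLIntegral_ball_add_left, hvol, div_eq_mul_inv, mul_assoc, ← ENNReal.div_eq_inv_mul]
        exact congrArg _ (setLAverage_eq (volume : Measure (Parabolic d)) f _).symm

/-! ### The gradient is dominated by a dyadic Riesz potential -/

lemma edist_le_tsum_edist_of_tendsto {X : Type*} [PseudoEMetricSpace X] {a : ℤ → X} {x y : X}
    (hx : Tendsto a atBot (𝓝 x)) (hy : Tendsto a atTop (𝓝 y)) :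
    edist x y ≤ ∑' k, edist (a k) (a (k + 1)) := by
  have hneg : Tendsto (fun n : ℕ => a (-n)) atTop (𝓝 x) :=
    hx.comp (tendsto_neg_atTop_atBot.comp tendsto_natCast_atTop_atTop)
  have hpos : Tendsto (fun n : ℕ => a n) atTop (𝓝 y) := hy.comp tendsto_natCast_atTop_atTop
  refine le_of_tendsto' (hneg.edist hpos) fun n => ?_
  calc edist (a (-n)) (a n)
      = edist (a (-n + (0 : ℕ))) (a (-n + (2 * n : ℕ))) := by
        congr 2
        · simp
        · push_cast
          ring
    _ ≤ ∑ i ∈ Finset.range (2 * n), edist (a (-n + i)) (a (-n + (i + 1 : ℕ))) :=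
        edist_le_range_sum_edist (fun i : ℕ => a (-n + i)) (2 * n)
    _ ≤ ∑' i : ℕ, edist (a (-n + i)) (a (-n + i + 1)) := by
        push_cast
        simp only [← add_assoc]
        exact ENNReal.sum_le_tsum _
    _ ≤ ∑' k, edist (a k) (a (k + 1)) :=
        ENNReal.tsum_comp_le_tsum_of_injective
          ((add_right_injective _).comp Nat.cast_injective) fun k => edist (a k) (a (k + 1))

lemma edist_le_mul_of_enorm_deriv_le {F : Type*} [NormedAddCommGroup F] [NormedSpace ℝ F]
    {f f' : ℝ → F} {a b : ℝ} {B : ℝ≥0∞} (hab : a ≤ b)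
    (hf : ∀ x ∈ Icc a b, HasDerivAt f (f' x) x) (hB : ∀ x ∈ Icc a b, ‖f' x‖ₑ ≤ B) :
    edist (f a) (f b) ≤ B * edist a b := by
  rcases eq_or_ne B ⊤ with rfl | hBt
  · rcases eq_or_ne a b with rfl | hne
    · simp
    · simp [ENNReal.top_mul (edist_pos.2 hne).ne']
  lift B to ℝ≥0 using hBt
  exact (convex_Icc a b).lipschitzOnWith_of_nnnorm_hasDerivWithin_le
    (fun x hx => (hf x hx).hasDerivWithinAt) (fun x hx => by exact_mod_cast hB x hx)
    (left_mem_Icc.2 hab) (right_mem_Icc.2 hab)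

lemma hasDerivAt_integral_mul_of_hasCompactSupport {E : Type*} [TopologicalSpace E]
    [MeasurableSpace E] [OpensMeasurableSpace E] {μ : Measure E} [IsFiniteMeasureOnCompacts μ]
    {G G' : ℝ → E → ℝ} {φ : E → ℝ} (hG : ∀ t, Continuous (G t))
    (hG' : Continuous (Function.uncurry G')) (hderiv : ∀ t x, HasDerivAt (G · x) (G' t x) t)
    (hφ : Continuous φ) (hφc : HasCompactSupport φ) (t : ℝ) :
    HasDerivAt (fun t => ∫ x, G t x * φ x ∂μ) (∫ x, G' t x * φ x ∂μ) t := by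
  have hintegrable : ∀ {g : E → ℝ}, Continuous g → Integrable (fun x => g x * φ x) μ := fun hg =>
    (hg.mul hφ).integrable_of_hasCompactSupport hφc.mul_left
  have hG'cont : ∀ t, Continuous (G' t) := fun t => hG'.comp (Continuous.prodMk_right t)
  obtain ⟨M, hM⟩ := ((isCompact_closedBall t 1).prod hφc.isCompact).exists_bound_of_continuousOn
    hG'.continuousOn
  refine (hasDerivAt_integral_of_dominated_loc_of_deriv_le (F := fun t x => G t x * φ x)
    (F' := fun t x => G' t x * φ x) (bound := fun x => M * ‖φ x‖) (ball_mem_nhds t one_pos)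
    (.of_forall fun s => (hintegrable (hG s)).aestronglyMeasurable) (hintegrable (hG t))
    (hintegrable (hG'cont t)).aestronglyMeasurable (.of_forall fun x s hs => ?_) ?_
    (.of_forall fun x s _ => (hderiv s x).mul_const _)).2
  · rw [norm_mul]
    by_cases hx : x ∈ tsupport φ
    · gcongr
      exact hM (s, x) ⟨ball_subset_closedBall hs, hx⟩
    · simp [image_eq_zero_of_notMem_tsupport hx]
  · exact (continuous_const.mul hφ.norm).integrable_of_hasCompactSupport hφc.norm.mul_left

lemma contDiff_lineDeriv {E F : Type*} [NormedAddCommGroup E] [NormedSpace ℝ E]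
    [NormedAddCommGroup F] [NormedSpace ℝ F] {n : WithTop ℕ∞} {u : E → F}
    (hu : ContDiff ℝ (n + 1) u) (e : E) : ContDiff ℝ n fun z => lineDeriv ℝ u z e := by
  have h : (fun z => lineDeriv ℝ u z e) = fun z => fderiv ℝ u z e :=
    funext fun z => (hu.differentiable (by simp) z).lineDeriv_eq_fderiv
  rw [h]
  exact (hu.fderiv_right le_rfl).clm_apply contDiff_const

lemma support_lineDeriv_subset {E F : Type*} [NormedAddCommGroup E] [NormedSpace ℝ E]
    [NormedAddCommGroup F] [NormedSpace ℝ F] (u : E → F) (e : E) :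
    Function.support (fun z => lineDeriv ℝ u z e) ⊆ tsupport u := fun z hz => by
  contrapose! hz
  have h : u =ᶠ[𝓝 z] 0 := notMem_tsupport_iff_eventuallyEq.1 hz
  rw [Function.notMem_support, h.lineDeriv_eq]
  simp [lineDeriv]

lemma lineDeriv_lineDeriv_comm {E F : Type*} [NormedAddCommGroup E] [NormedSpace ℝ E]
    [NormedAddCommGroup F] [NormedSpace ℝ F] {u : E → F} (hu : ContDiff ℝ 2 u) (z e e' : E) :
    lineDeriv ℝ (fun x => lineDeriv ℝ u x e) z e' =
      lineDeriv ℝ (fun x => lineDeriv ℝ u x e') z e := by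
  have hu' : DifferentiableAt ℝ (fderiv ℝ u) z :=
    (hu.fderiv_right (m := 1) le_rfl).differentiable one_ne_zero z
  have hsnd : ∀ e e', lineDeriv ℝ (fun x => lineDeriv ℝ u x e) z e' =
      fderiv ℝ (fderiv ℝ u) z e' e := fun e e' => by
    have h : (fun z => lineDeriv ℝ u z e) = fun z => fderiv ℝ u z e :=
      funext fun z => (hu.differentiable two_ne_zero z).lineDeriv_eq_fderiv
    rw [h, (hu'.clm_apply (differentiableAt_const e)).lineDeriv_eq_fderiv,
      fderiv_clm_apply hu' (differentiableAt_const e)]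
    simp
  rw [hsnd, hsnd]
  exact (hu.contDiffAt.isSymmSndFDerivAt (by simp)).eq _ _

variable {u v φ : Spacetime d → ℝ}

lemma fderiv_eq_timeDeriv_add_sum (hv : ContDiff ℝ 1 v)
    (z : Spacetime d) (s : ℝ) (y : EuclideanSpace ℝ (Fin d)) :
    fderiv ℝ v z (s, y) = s * timeDeriv v z + ∑ j, y j * spaceDeriv j v z := by
  have hsplit : ((s, y) : Spacetime d) = s • ((1, 0) : Spacetime d) +
      ∑ j, y j • ((0, EuclideanSpace.single j 1) : Spacetime d) := by
    refine Prod.ext (by simp [Prod.fst_sum]) ?_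
    simpa [Prod.snd_sum] using ((EuclideanSpace.basisFun (Fin d) ℝ).sum_repr y).symm
  have hline : ∀ e, fderiv ℝ v z e = lineDeriv ℝ v z e := fun e =>
    (hv.differentiable one_ne_zero z).lineDeriv_eq_fderiv.symm
  rw [hsplit, map_add, map_smul, map_sum]
  simp only [map_smul, smul_eq_mul]
  simp only [hline]
  rfl

lemma abs_timeDeriv_le_hessTimeNorm (u : Spacetime d → ℝ) (z : Spacetime d) :
    |timeDeriv u z| ≤ hessTimeNorm u z :=
  Real.abs_le_sqrt (le_add_of_nonneg_left (by positivity))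

lemma abs_spaceDeriv_spaceDeriv_le_hessTimeNorm (u : Spacetime d → ℝ) (z : Spacetime d)
    (i j : Fin d) : |spaceDeriv i (spaceDeriv j u) z| ≤ hessTimeNorm u z := by
  refine Real.abs_le_sqrt (le_add_of_le_of_nonneg ?_ (sq_nonneg _))
  calc spaceDeriv i (spaceDeriv j u) z ^ 2
      ≤ ∑ j, spaceDeriv i (spaceDeriv j u) z ^ 2 :=
        Finset.single_le_sum (f := fun j => spaceDeriv i (spaceDeriv j u) z ^ 2)
          (fun _ _ => sq_nonneg _) (Finset.mem_univ j)
    _ ≤ ∑ i, ∑ j, spaceDeriv i (spaceDeriv j u) z ^ 2 :=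
        Finset.single_le_sum (f := fun i => ∑ j, spaceDeriv i (spaceDeriv j u) z ^ 2)
          (fun _ _ => Finset.sum_nonneg fun _ _ => sq_nonneg _) (Finset.mem_univ i)

lemma continuous_hessTimeNorm (hu : ContDiff ℝ 2 u) : Continuous (hessTimeNorm u) := by
  have hu₁ : ∀ e, ContDiff ℝ 1 fun z => lineDeriv ℝ u z e := contDiff_lineDeriv hu
  have htime : Continuous (timeDeriv u) := (hu₁ _).continuous
  have hspace : ∀ i j, Continuous (spaceDeriv i (spaceDeriv j u)) := fun i j =>
    (contDiff_lineDeriv (n := 0) (hu₁ _) _).continuous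
  unfold hessTimeNorm
  fun_prop

lemma enorm_spaceGrad_le_sum (u : Spacetime d → ℝ) (z : Spacetime d) :
    ‖spaceGrad u z‖ₑ ≤ ∑ i, ‖spaceDeriv i u z‖ₑ := by
  have h : spaceGrad u z = ∑ i, spaceDeriv i u z • EuclideanSpace.single i (1 : ℝ) := by
    simpa [spaceGrad] using ((EuclideanSpace.basisFun (Fin d) ℝ).sum_repr (spaceGrad u z)).symm
  rw [h]
  refine (enorm_sum_le _ _).trans_eq (Finset.sum_congr rfl fun i _ => ?_)
  rw [enorm_smul]
  simp [enorm]

/-- The parabolic dilation `(s, y) ↦ (ε² s, ε y)`. -/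
def dil (ε : ℝ) (w : Spacetime d) : Spacetime d := (ε ^ 2 * w.1, ε • w.2)

lemma continuous_dil : Continuous fun x : ℝ × Spacetime d => dil x.1 x.2 := by
  unfold dil
  fun_prop

lemma measurableEmbedding_dil {ε : ℝ} (hε : ε ≠ 0) :
    MeasurableEmbedding (dil ε : Spacetime d → Spacetime d) :=
  ((Homeomorph.smulOfNeZero (ε ^ 2) (pow_ne_zero 2 hε)).prodCongr
    (Homeomorph.smulOfNeZero ε hε)).measurableEmbedding

lemma hasDerivAt_dil (w : Spacetime d) (ε : ℝ) :
    HasDerivAt (fun ε => dil ε w) (2 * ε * w.1, w.2) ε := by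
  have htime : HasDerivAt (fun ε : ℝ => ε ^ 2 * w.1) (2 * ε * w.1) ε := by
    simpa using (hasDerivAt_pow 2 ε).mul_const w.1
  have hspace : HasDerivAt (fun ε : ℝ => ε • w.2) w.2 ε := by
    simpa using (hasDerivAt_id ε).smul_const w.2
  exact htime.prodMk hspace

lemma map_dil_volume {ε : ℝ} (hε : 0 < ε) :
    Measure.map (dil ε) (volume : Measure (Spacetime d)) =
      (ENNReal.ofReal ε ^ (d + 2))⁻¹ • volume := by
  have h : (dil ε : Spacetime d → Spacetime d) =
      Prod.map (fun s : ℝ => ε ^ 2 • s) (fun y : EuclideanSpace ℝ (Fin d) => ε • y) := rfl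
  rw [h, Measure.volume_eq_prod, ← Measure.map_prod_map _ _ (measurable_const_smul _)
    (measurable_const_smul _), Measure.map_addHaar_smul _ (by positivity),
    Measure.map_addHaar_smul _ hε.ne', Measure.prod_smul_left, Measure.prod_smul_right, smul_smul,
    ← ENNReal.ofReal_mul (by positivity), ← ENNReal.ofReal_pow hε.le,
    ← ENNReal.ofReal_inv_of_pos (by positivity)]
  congr 2
  rw [abs_of_pos (by positivity), abs_of_pos (by positivity), Module.finrank_self,
    finrank_euclideanSpace_fin, ← mul_inv]
  ring

lemma toParabolic_mem_ball_zero {w : Spacetime d} {r : ℝ} (hr : 0 < r) :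
    toParabolic w ∈ ball (toParabolic 0) r ↔ |w.1| < r ^ 2 ∧ ‖w.2‖ < r := by
  rw [Parabolic.mem_ball hr]
  simp [toParabolic]

lemma preimage_dil_ball {ε : ℝ} (hε : 0 < ε) :
    dil ε ⁻¹' (toParabolic ⁻¹' ball (toParabolic (0 : Spacetime d)) ε) =
      toParabolic ⁻¹' ball (toParabolic 0) 1 := by
  ext w
  simp only [mem_preimage, toParabolic_mem_ball_zero hε, toParabolic_mem_ball_zero one_pos, dil,
    abs_mul, norm_smul, abs_pow, Real.norm_eq_abs, abs_of_pos hε, one_pow]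
  rw [mul_lt_iff_lt_one_right (by positivity), mul_lt_iff_lt_one_right hε]

lemma lintegral_comp_add_dil (f : Spacetime d → ℝ≥0∞) (z : Spacetime d) {ε : ℝ} (hε : 0 < ε) :
    ∫⁻ w in toParabolic ⁻¹' ball (toParabolic 0) 1, f (z + dil ε w) =
      volume (ball (toParabolic (0 : Spacetime d)) 1) *
        ⨍⁻ x in ball (toParabolic z) ε, f x ∂(volume : Measure (Parabolic d)) := by
  have havg : ⨍⁻ x in ball (toParabolic z) ε, f x ∂(volume : Measure (Parabolic d)) =
      (volume (ball (toParabolic z) ε))⁻¹ *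
        ∫⁻ x in toParabolic ⁻¹' ball (toParabolic z) ε, f x :=
    (setLAverage_eq (volume : Measure (Parabolic d)) f _).trans ENNReal.div_eq_inv_mul
  have hvol : volume (ball (toParabolic (0 : Spacetime d)) 1) * (volume (ball (toParabolic z) ε))⁻¹
      = (ENNReal.ofReal ε ^ (d + 2))⁻¹ := by
    have hne := (Parabolic.isDoubling_volume d).measure_ball_ne_zero (toParabolic 0) 1 one_pos
    have hne' := (Parabolic.isDoubling_volume d).measure_ball_ne_top (toParabolic 0) 1
    have hscale : volume (ball (toParabolic z) ε) =
        ENNReal.ofReal ε ^ (d + 2) * volume (ball (toParabolic (0 : Spacetime d)) 1) := by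
      simp only [Parabolic.volume_ball _ hε, Parabolic.volume_ball _ one_pos, ENNReal.ofReal_one,
        one_pow, one_mul]
    rw [hscale, ENNReal.mul_inv (.inr hne') (.inr hne), mul_left_comm,
      ENNReal.mul_inv_cancel hne hne', mul_one]
  rw [havg, ← mul_assoc, hvol, ← preimage_dil_ball hε, ← setLIntegral_ball_add_left f z,
    ← (measurableEmbedding_dil hε.ne').lintegral_map (fun x => f (z + x)),
    ← (measurableEmbedding_dil hε.ne').restrict_map, map_dil_volume hε, Measure.restrict_smul,
    lintegral_smul_measure, smul_eq_mul]

/-- The weighted average `∫ v(t + ε² s, x + ε y) φ(s, y) ds dy` of `v` at the parabolic scale `ε`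
about `z = (t, x)`. -/
def scaleAvg (φ v : Spacetime d → ℝ) (z : Spacetime d) (ε : ℝ) : ℝ :=
  ∫ w, v (z + dil ε w) * φ w

lemma integrable_comp_dil_mul (hv : Continuous v) (hφ : Continuous φ) (hφc : HasCompactSupport φ)
    (z : Spacetime d) (ε : ℝ) : Integrable fun w => v (z + dil ε w) * φ w := by
  have hdil : Continuous (dil ε : Spacetime d → Spacetime d) :=
    continuous_dil.comp (Continuous.prodMk_right ε)
  exact ((hv.comp (continuous_const.add hdil)).mul hφ).integrable_of_hasCompactSupport
    hφc.mul_left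

lemma hasDerivAt_scaleAvg (hv : ContDiff ℝ 1 v) (hφ : Continuous φ) (hφc : HasCompactSupport φ)
    (z : Spacetime d) (ε : ℝ) :
    HasDerivAt (scaleAvg φ v z)
      (∑ j, scaleAvg (fun w => w.2 j * φ w) (spaceDeriv j v) z ε +
        2 * ε * scaleAvg (fun w => w.1 * φ w) (timeDeriv v) z ε) ε := by
  have hdil : Continuous fun x : ℝ × Spacetime d => z + dil x.1 x.2 :=
    continuous_const.add continuous_dil
  have hderiv := hasDerivAt_integral_mul_of_hasCompactSupport (μ := volume)
    (G := fun ε w => v (z + dil ε w))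
    (G' := fun ε w => fderiv ℝ v (z + dil ε w) (2 * ε * w.1, w.2))
    (fun t => hv.continuous.comp (hdil.comp (Continuous.prodMk_right t)))
    (((hv.continuous_fderiv one_ne_zero).comp hdil).clm_apply (by fun_prop))
    (fun t w => (hv.differentiable one_ne_zero _).hasFDerivAt.comp_hasDerivAt t
      ((hasDerivAt_dil w t).const_add z)) hφ hφc ε
  have hspace : ∀ j ∈ Finset.univ,
      Integrable fun w => spaceDeriv j v (z + dil ε w) * (w.2 j * φ w) := fun j _ =>
    integrable_comp_dil_mul (contDiff_lineDeriv (n := 0) hv _).continuous (by fun_prop)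
      hφc.mul_left z ε
  have htime : Integrable fun w => timeDeriv v (z + dil ε w) * (w.1 * φ w) :=
    integrable_comp_dil_mul (contDiff_lineDeriv (n := 0) hv _).continuous (by fun_prop)
      hφc.mul_left z ε
  refine hderiv.congr_deriv ?_
  simp only [scaleAvg]
  rw [← integral_finsetSum _ hspace, ← integral_const_mul,
    ← integral_add (integrable_finsetSum _ hspace) (htime.const_mul _)]
  congr with w
  rw [fderiv_eq_timeDeriv_add_sum hv, add_mul, Finset.sum_mul, add_comm]
  congr 1
  · exact Finset.sum_congr rfl fun j _ => by ring
  · ring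

lemma mul_scaleAvg_spaceDeriv (hv : ContDiff ℝ 1 v) (hφ : ContDiff ℝ 1 φ)
    (hφc : HasCompactSupport φ) (i : Fin d) (z : Spacetime d) (ε : ℝ) :
    ε * scaleAvg φ (spaceDeriv i v) z ε = -scaleAvg (spaceDeriv i φ) v z ε := by
  set e : Spacetime d := (0, EuclideanSpace.single i 1) with he
  have hline : ∀ {g : Spacetime d → ℝ}, ContDiff ℝ 1 g → ∀ x,
      HasLineDerivAt ℝ g (spaceDeriv i g x) x e := fun hg x =>
    (hg.differentiable one_ne_zero x).lineDifferentiableAt.hasLineDerivAt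
  have hline_dil : ∀ w, HasLineDerivAt ℝ (fun w => v (z + dil ε w))
      (ε * spaceDeriv i v (z + dil ε w)) w e := fun w => by
    have htranslate : ∀ t : ℝ, z + dil ε (w + t • e) = (z + dil ε w) + t • (ε • e) := fun t => by
      refine Prod.ext ?_ ?_
      · simp [dil, he]
      · simp [dil, he, add_assoc, smul_smul, mul_comm]
    have h := (hline hv (z + dil ε w)).smul ε
    unfold HasLineDerivAt at h ⊢
    simpa only [htranslate, smul_eq_mul] using h
  have hv' : Continuous (spaceDeriv i v) := (contDiff_lineDeriv (n := 0) hv e).continuous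
  have hφ' : Continuous (spaceDeriv i φ) := (contDiff_lineDeriv (n := 0) hφ e).continuous
  have hparts := integral_bilinear_hasLineDerivAt_right_eq_neg_left_of_integrable
    (μ := (volume : Measure (Spacetime d))) (B := ContinuousLinearMap.mul ℝ ℝ)
    (f := fun w => v (z + dil ε w)) (g := φ)
    (by simpa [mul_assoc] using
      (integrable_comp_dil_mul hv' hφ.continuous hφc z ε).const_mul ε)
    (integrable_comp_dil_mul hv.continuous hφ' (hφc.mono' (support_lineDeriv_subset φ e)) z ε)
    (integrable_comp_dil_mul hv.continuous hφ.continuous hφc z ε)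
    (fun w _ => hline_dil w) (fun w _ => hline hφ w)
  simp only [ContinuousLinearMap.mul_apply', mul_assoc, integral_const_mul] at hparts
  exact (neg_eq_iff_eq_neg.2 hparts).symm

/-- The time derivative of `D_i u`, which would be of third order, is removed by integrating `D_i`
by parts onto the weight. -/
lemma hasDerivAt_scaleAvg_spaceDeriv (hu : ContDiff ℝ 2 u) (hφ : ContDiff ℝ 1 φ)
    (hφc : HasCompactSupport φ) (i : Fin d) (z : Spacetime d) (ε : ℝ) :
    HasDerivAt (scaleAvg φ (spaceDeriv i u) z)
      (∑ j, scaleAvg (fun w => w.2 j * φ w) (spaceDeriv j (spaceDeriv i u)) z ε -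
        2 * scaleAvg (spaceDeriv i fun w => w.1 * φ w) (timeDeriv u) z ε) ε := by
  have hcomm : timeDeriv (spaceDeriv i u) = spaceDeriv i (timeDeriv u) :=
    funext fun x => lineDeriv_lineDeriv_comm hu x _ _
  have hparts := mul_scaleAvg_spaceDeriv (v := timeDeriv u) (contDiff_lineDeriv hu _)
    (contDiff_fst.mul hφ) hφc.mul_left i z ε
  refine (hasDerivAt_scaleAvg (contDiff_lineDeriv hu _) hφ.continuous hφc z ε).congr_deriv ?_
  change _ + 2 * ε * scaleAvg _ (timeDeriv (spaceDeriv i u)) z ε = _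
  rw [hcomm, mul_assoc, hparts, mul_neg, ← sub_eq_add_neg]
  rfl

lemma exists_enorm_scaleAvg_le (hφ : Continuous φ) (hφc : HasCompactSupport φ)
    (hφs : Function.support φ ⊆ toParabolic ⁻¹' ball (toParabolic 0) 1) :
    ∃ C : ℝ≥0, ∀ (v : Spacetime d → ℝ) z ε, 0 < ε →
      ‖scaleAvg φ v z ε‖ₑ ≤
        C * ⨍⁻ x in ball (toParabolic z) ε, ‖v x‖ₑ ∂(volume : Measure (Parabolic d)) := by
  obtain ⟨M, hM⟩ := hφc.exists_bound_of_continuous hφ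
  have hball := (Parabolic.isDoubling_volume d).measure_ball_ne_top (toParabolic 0) 1
  refine ⟨(ENNReal.ofReal M * volume (ball (toParabolic (0 : Spacetime d)) 1)).toNNReal,
    fun v z ε hε => ?_⟩
  rw [ENNReal.coe_toNNReal (by finiteness), mul_assoc,
    ← lintegral_comp_add_dil (fun x => ‖v x‖ₑ) z hε,
    ← lintegral_const_mul' _ _ ENNReal.ofReal_ne_top]
  calc ‖scaleAvg φ v z ε‖ₑ
      ≤ ∫⁻ w, ‖v (z + dil ε w) * φ w‖ₑ := enorm_integral_le_lintegral_enorm _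
    _ = ∫⁻ w in toParabolic ⁻¹' ball (toParabolic 0) 1, ‖v (z + dil ε w) * φ w‖ₑ := by
        refine (setLIntegral_eq_of_support_subset fun w hw => hφs fun h => hw ?_).symm
        simp [h]
    _ ≤ ∫⁻ w in toParabolic ⁻¹' ball (toParabolic 0) 1,
          ENNReal.ofReal M * ‖v (z + dil ε w)‖ₑ := by
        refine lintegral_mono fun w => ?_
        rw [enorm_mul, mul_comm]
        gcongr
        rw [← ofReal_norm]
        exact ENNReal.ofReal_le_ofReal (hM w)

lemma scaleAvg_zero (φ v : Spacetime d → ℝ) (z : Spacetime d) :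
    scaleAvg φ v z 0 = v z * ∫ w, φ w := by
  have hdil : ∀ w : Spacetime d, dil 0 w = 0 := fun w => by simp [dil]
  simp only [scaleAvg, hdil, add_zero, integral_const_mul]

lemma tendsto_scaleAvg_atTop (hv : Integrable v) (hφ : Continuous φ) (hφc : HasCompactSupport φ)
    (hφs : Function.support φ ⊆ toParabolic ⁻¹' ball (toParabolic 0) 1) (z : Spacetime d) :
    Tendsto (scaleAvg φ v z) atTop (𝓝 0) := by
  obtain ⟨C, hC⟩ := exists_enorm_scaleAvg_le hφ hφc hφs
  have hvol : Tendsto (fun ε => volume (ball (toParabolic z) ε)) atTop (𝓝 ∞) := by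
    have hc := (measure_ball_pos volume (0 : EuclideanSpace ℝ (Fin d)) one_pos).ne'
    have h := ENNReal.Tendsto.mul_const (b := 2 * volume (ball (0 : EuclideanSpace ℝ (Fin d)) 1))
      (ENNReal.Tendsto.pow (n := d + 2) ENNReal.tendsto_ofReal_atTop) (.inl (by simp))
    rw [ENNReal.top_pow (by simp), ENNReal.top_mul (by positivity)] at h
    refine h.congr' ?_
    filter_upwards [eventually_gt_atTop 0] with ε hε using (Parabolic.volume_ball _ hε).symm
  have hlim : Tendsto (fun ε => C * ((∫⁻ x, ‖v x‖ₑ) / volume (ball (toParabolic z) ε))) atTop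
      (𝓝 0) := by
    have h := ENNReal.Tendsto.const_mul (a := C)
      (ENNReal.Tendsto.const_div hvol (.inr hv.2.ne)) (.inr ENNReal.coe_ne_top)
    simpa using h
  rw [tendsto_zero_iff_enorm_tendsto_zero]
  refine tendsto_of_tendsto_of_tendsto_of_le_of_le' tendsto_const_nhds hlim
    (.of_forall fun _ => zero_le) ?_
  filter_upwards [eventually_gt_atTop 0] with ε hε
  refine (hC v z ε hε).trans (mul_le_mul_right ?_ _)
  rw [setLAverage_eq]
  exact ENNReal.div_le_div_right (setLIntegral_le_lintegral _ _) _

lemma exists_contDiff_integral_eq_one (d : ℕ) :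
    ∃ φ : Spacetime d → ℝ, ContDiff ℝ 1 φ ∧ HasCompactSupport φ ∧
      tsupport φ ⊆ toParabolic ⁻¹' ball (toParabolic 0) 1 ∧ ∫ w, φ w = 1 := by
  let f : ContDiffBump (0 : Spacetime d) := ⟨1 / 4, 1 / 2, by norm_num, by norm_num⟩
  refine ⟨f.normed volume, f.contDiff_normed, f.hasCompactSupport_normed, fun w hw => ?_,
    f.integral_normed⟩
  rw [f.tsupport_normed_eq, mem_closedBall_zero_iff] at hw
  have hw' : ‖w‖ < 1 := hw.trans_lt (by norm_num)
  exact (toParabolic_mem_ball_zero one_pos).2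
    ⟨by simpa using (norm_fst_le w).trans_lt hw', (norm_snd_le w).trans_lt hw'⟩

lemma exists_enorm_deriv_scaleAvg_le (hφ : ContDiff ℝ 1 φ) (hφc : HasCompactSupport φ)
    (hφs : tsupport φ ⊆ toParabolic ⁻¹' ball (toParabolic 0) 1) (i : Fin d) :
    ∃ C : ℝ≥0, ∀ u : Spacetime d → ℝ, ContDiff ℝ 2 u → ∀ z ε, 0 < ε →
      ‖deriv (scaleAvg φ (spaceDeriv i u) z) ε‖ₑ ≤
        C * ⨍⁻ x in ball (toParabolic z) ε, ‖hessTimeNorm u x‖ₑ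
          ∂(volume : Measure (Parabolic d)) := by
  have hspace : ∀ j : Fin d, Function.support (fun w => w.2 j * φ w) ⊆ tsupport φ := fun j =>
    (Function.support_mul_subset_right _ _).trans (subset_tsupport φ)
  have htime : Function.support (spaceDeriv i fun w => w.1 * φ w) ⊆ tsupport φ :=
    (support_lineDeriv_subset _ _).trans (tsupport_mul_subset_right (f := Prod.fst))
  choose C hC using fun j : Fin d => exists_enorm_scaleAvg_le (φ := fun w => w.2 j * φ w)
    (Continuous.mul (by fun_prop) hφ.continuous) hφc.mul_left ((hspace j).trans hφs)
  obtain ⟨K, hK⟩ := exists_enorm_scaleAvg_le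
    (contDiff_lineDeriv (n := 0) (contDiff_fst.mul hφ) (0, EuclideanSpace.single i 1)).continuous
    (hφc.mono' htime) (htime.trans hφs)
  refine ⟨∑ j, C j + 2 * K, fun u hu z ε hε => ?_⟩
  set A := ⨍⁻ x in ball (toParabolic z) ε, ‖hessTimeNorm u x‖ₑ ∂(volume : Measure (Parabolic d))
  have havg : ∀ {v : Spacetime d → ℝ}, (∀ x, |v x| ≤ hessTimeNorm u x) →
      ⨍⁻ x in ball (toParabolic z) ε, ‖v x‖ₑ ∂(volume : Measure (Parabolic d)) ≤ A := fun hv =>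
    lintegral_mono fun x => enorm_le_iff_norm_le.2 ((hv x).trans (le_abs_self _))
  rw [(hasDerivAt_scaleAvg_spaceDeriv hu hφ hφc i z ε).deriv]
  calc _ ≤ ∑ j, ‖scaleAvg (fun w => w.2 j * φ w) (spaceDeriv j (spaceDeriv i u)) z ε‖ₑ +
        ‖2 * scaleAvg (spaceDeriv i fun w => w.1 * φ w) (timeDeriv u) z ε‖ₑ :=
        (enorm_sub_le).trans (add_le_add_left (enorm_sum_le _ _) _)
    _ ≤ ∑ j, C j * A + 2 * (K * A) := by
        gcongr with j
        · exact (hC j _ z ε hε).trans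
            (mul_le_mul_right (havg fun x => abs_spaceDeriv_spaceDeriv_le_hessTimeNorm u x j i) _)
        · rw [enorm_mul, Real.enorm_of_nonneg zero_le_two, ENNReal.ofReal_ofNat]
          gcongr
          exact (hK _ z ε hε).trans
            (mul_le_mul_right (havg (abs_timeDeriv_le_hessTimeNorm u)) _)
    _ = (∑ j, C j + 2 * K : ℝ≥0) * A := by
        push_cast
        rw [add_mul, Finset.sum_mul, mul_assoc]

lemma exists_edist_scaleAvg_le (hφ : ContDiff ℝ 1 φ) (hφc : HasCompactSupport φ)
    (hφs : tsupport φ ⊆ toParabolic ⁻¹' ball (toParabolic 0) 1) (i : Fin d) :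
    ∃ C : ℝ≥0, ∀ u : Spacetime d → ℝ, ContDiff ℝ 2 u → ∀ z (k : ℤ),
      edist (scaleAvg φ (spaceDeriv i u) z (2 ^ k))
          (scaleAvg φ (spaceDeriv i u) z (2 ^ (k + 1))) ≤
        C * (2 ^ (k + 1) * ⨍⁻ x in ball (toParabolic z) (2 ^ (k + 1)), ‖hessTimeNorm u x‖ₑ
          ∂(volume : Measure (Parabolic d))) := by
  obtain ⟨C, hC⟩ := exists_enorm_deriv_scaleAvg_le hφ hφc hφs i
  refine ⟨C * 2 ^ (d + 2), fun u hu z k => ?_⟩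
  have hk : (0 : ℝ) < 2 ^ k := by positivity
  have hk' : (2 : ℝ) ^ (k + 1) = 2 * 2 ^ k := by rw [zpow_add_one₀ two_ne_zero, mul_comm]
  have hdouble := Parabolic.isDoubling_volume d
  set A := ⨍⁻ x in ball (toParabolic z) (2 ^ (k + 1)), ‖hessTimeNorm u x‖ₑ
    ∂(volume : Measure (Parabolic d))
  have hderiv : ∀ ε ∈ Icc ((2 : ℝ) ^ k) (2 ^ (k + 1)),
      ‖deriv (scaleAvg φ (spaceDeriv i u) z) ε‖ₑ ≤ C * ((2 ^ (d + 2) : ℝ≥0) * A) := by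
    intro ε hε
    have hε₀ : 0 < ε := hk.trans_le hε.1
    refine (hC u hu z ε hε₀).trans (mul_le_mul_right ?_ _)
    refine setLAverage_le_of_subset (ball_subset_ball hε.2)
      (hdouble.measure_ball_ne_top _ _) ?_ _
    refine (measure_mono (ball_subset_ball ?_)).trans (hdouble.measure_ball_two_mul_le _ _ hε₀)
    rw [hk']
    linarith [hε.1]
  have hdist : edist ((2 : ℝ) ^ k) (2 ^ (k + 1)) ≤ 2 ^ (k + 1) := by
    rw [← ofReal_two_zpow, edist_comm, edist_dist, Real.dist_eq, hk']
    refine ENNReal.ofReal_le_ofReal ?_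
    rw [abs_of_pos (by linarith)]
    linarith
  calc _ ≤ C * ((2 ^ (d + 2) : ℝ≥0) * A) * edist ((2 : ℝ) ^ k) (2 ^ (k + 1)) :=
        edist_le_mul_of_enorm_deriv_le (by linarith) (fun ε _ =>
          (hasDerivAt_scaleAvg_spaceDeriv hu hφ hφc i z ε).differentiableAt.hasDerivAt) hderiv
    _ ≤ C * ((2 ^ (d + 2) : ℝ≥0) * A) * 2 ^ (k + 1) := mul_le_mul_right hdist _
    _ = (C * 2 ^ (d + 2) : ℝ≥0) * (2 ^ (k + 1) * A) := by
        push_cast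
        ring

lemma exists_enorm_spaceDeriv_le_dyadicRiesz (i : Fin d) :
    ∃ C : ℝ≥0, ∀ u : Spacetime d → ℝ, ContDiff ℝ 2 u → HasCompactSupport u → ∀ z,
      ‖spaceDeriv i u z‖ₑ ≤ C * dyadicRiesz (volume : Measure (Parabolic d)) 1
        (fun x => ‖hessTimeNorm u x‖ₑ) (toParabolic z) := by
  obtain ⟨φ, hφ, hφc, hφs, hφ₁⟩ := exists_contDiff_integral_eq_one d
  obtain ⟨C, hC⟩ := exists_edist_scaleAvg_le hφ hφc hφs i
  refine ⟨C, fun u hu hc z => ?_⟩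
  set v := spaceDeriv i u
  have hv : ContDiff ℝ 1 v := contDiff_lineDeriv hu _
  have hvint : Integrable v := hv.continuous.integrable_of_hasCompactSupport
    (hc.mono' (support_lineDeriv_subset u _))
  have hzero : Tendsto (fun k : ℤ => scaleAvg φ v z (2 ^ k)) atBot (𝓝 (v z)) := by
    have h := (hasDerivAt_scaleAvg hv hφ.continuous hφc z 0).continuousAt.tendsto
    rw [scaleAvg_zero, hφ₁, mul_one] at h
    refine h.comp ?_
    simpa [Function.comp_def] using (tendsto_rpow_atBot_of_base_gt_one 2 one_lt_two).comp
      (tendsto_intCast_atBot_iff (R := ℝ).2 tendsto_id)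
  have htop : Tendsto (fun k : ℤ => scaleAvg φ v z (2 ^ k)) atTop (𝓝 0) := by
    refine (tendsto_scaleAvg_atTop hvint hφ.continuous hφc
      ((subset_tsupport φ).trans hφs) z).comp ?_
    simpa [Function.comp_def] using (tendsto_rpow_atTop_of_base_gt_one 2 one_lt_two).comp
      (tendsto_intCast_atTop_atTop (R := ℝ))
  calc ‖v z‖ₑ = edist (v z) 0 := (edist_zero_right _).symm
    _ ≤ ∑' k : ℤ, edist (scaleAvg φ v z (2 ^ k)) (scaleAvg φ v z (2 ^ (k + 1))) :=
        edist_le_tsum_edist_of_tendsto hzero htop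
    _ ≤ ∑' k : ℤ, C * (2 ^ (k + 1) * ⨍⁻ x in ball (toParabolic z) (2 ^ (k + 1)),
          ‖hessTimeNorm u x‖ₑ ∂(volume : Measure (Parabolic d))) :=
        ENNReal.tsum_le_tsum (hC u hu z)
    _ = C * dyadicRiesz (volume : Measure (Parabolic d)) 1
          (fun x => ‖hessTimeNorm u x‖ₑ) (toParabolic z) := by
        rw [ENNReal.tsum_mul_left, dyadicRiesz]
        simp only [ENNReal.rpow_one]
        exact congrArg _ ((Equiv.addRight (1 : ℤ)).tsum_eq fun k => (2 : ℝ≥0∞) ^ k *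
          ⨍⁻ x in ball (toParabolic z) (2 ^ k), ‖hessTimeNorm u x‖ₑ
            ∂(volume : Measure (Parabolic d)))

lemma exists_enorm_spaceGrad_le_dyadicRiesz (d : ℕ) :
    ∃ C : ℝ≥0, ∀ u : Spacetime d → ℝ, ContDiff ℝ 2 u → HasCompactSupport u → ∀ z,
      ‖spaceGrad u z‖ₑ ≤ C * dyadicRiesz (volume : Measure (Parabolic d)) 1
        (fun x => ‖hessTimeNorm u x‖ₑ) (toParabolic z) := by
  choose C hC using fun i : Fin d => exists_enorm_spaceDeriv_le_dyadicRiesz i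
  refine ⟨∑ i, C i, fun u hu hc z => ?_⟩
  push_cast
  rw [Finset.sum_mul]
  exact (enorm_spaceGrad_le_sum u z).trans (Finset.sum_le_sum fun i _ => hC i u hu hc z)

/-! ### The trace inequality -/

lemma eLpNorm_ofReal_rpow {X E : Type*} [MeasurableSpace X] {μ : Measure X} [TopologicalSpace E]
    [ENormedAddMonoid E] {p : ℝ} (hp : 0 < p) (f : X → E) :
    eLpNorm f (ENNReal.ofReal p) μ ^ p = ∫⁻ x, ‖f x‖ₑ ^ p ∂μ := by
  have h := eLpNorm_nnreal_pow_eq_lintegral (f := f) (μ := μ) (p := p.toNNReal) (by simpa using hp)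
  rwa [Real.coe_toNNReal p hp.le] at h

theorem exists_lintegral_mul_rpow_le_of_le_dyadicRiesz (d : ℕ) {p q α : ℝ} (hp : 1 < p)
    (hpq : p < q) (hα : 0 < α) (K : ℝ≥0) :
    ∃ N : ℝ≥0, ∀ (m : ℕ) (b : Spacetime d → EuclideanSpace ℝ (Fin m)),
      AEStronglyMeasurable b volume → ∀ f g : Spacetime d → ℝ≥0∞, AEMeasurable f volume →
      (∀ z, g z ≤ K * dyadicRiesz (volume : Measure (Parabolic d)) α f (toParabolic z)) →
        ∫⁻ z, ‖b z‖ₑ ^ p * g z ^ p ≤ N * morreyNorm q α b ^ p * ∫⁻ z, f z ^ p := by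
  have hp₀ : 0 ≤ p := by linarith
  have hq : 0 < q := by linarith
  obtain ⟨C, hC⟩ :=
    (Parabolic.isDoubling_volume d).exists_lintegral_mul_dyadicRiesz_rpow_le hα hp hpq
  refine ⟨K ^ p * C * ((2 ^ (d + 2)) ^ (1 / q)) ^ p, fun m b hb f g hf hg => ?_⟩
  set I : Spacetime d → ℝ≥0∞ := fun z =>
    dyadicRiesz (volume : Measure (Parabolic d)) α f (toParabolic z)
  have hK : (K : ℝ≥0∞) ^ p ≠ ⊤ := ENNReal.rpow_ne_top_of_nonneg hp₀ ENNReal.coe_ne_top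
  calc ∫⁻ z, ‖b z‖ₑ ^ p * g z ^ p ≤ ∫⁻ z, K ^ p * (‖b z‖ₑ * I z) ^ p := by
        refine lintegral_mono fun z => ?_
        rw [← ENNReal.mul_rpow_of_nonneg _ _ hp₀, ← ENNReal.mul_rpow_of_nonneg _ _ hp₀,
          mul_left_comm]
        exact ENNReal.rpow_le_rpow (mul_le_mul_right (hg z) _) hp₀
    _ = K ^ p * ∫⁻ z, (‖b z‖ₑ * I z) ^ p := lintegral_const_mul' _ _ hK
    _ ≤ K ^ p * (C * ballMorreyNorm (X := Parabolic d) volume q α (fun z => ‖b z‖ₑ) ^ p *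
          ∫⁻ z, f z ^ p) := mul_le_mul_right (hC _ f hb.enorm hf) _
    _ ≤ K ^ p * (C * ((2 ^ (d + 2)) ^ (1 / q) * morreyNorm q α b) ^ p * ∫⁻ z, f z ^ p) := by
        gcongr
        exact ballMorreyNorm_le_morreyNorm hq hα.le b
    _ = _ := by
        rw [ENNReal.mul_rpow_of_nonneg _ _ hp₀]
        push_cast [ENNReal.coe_rpow_of_nonneg _ hp₀,
          ENNReal.coe_rpow_of_nonneg _ (one_div_pos.2 hq).le]
        ring

end ParabolicMorrey

end

open ParabolicMorrey in
theorem theorem4p1_general (d : ℕ) {p q α : ℝ} (hp : 1 < p) (hpq : p < q) (hα : 0 < α) :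
    ∃ N : ℝ≥0, ∀ (m : ℕ) (b : Spacetime d → EuclideanSpace ℝ (Fin m)),
      AEStronglyMeasurable b volume →
      (∀ f : Spacetime d → ℝ≥0∞, AEMeasurable f volume →
        ∫⁻ z, ‖b z‖ₑ ^ p * potential α f z ^ p ≤
          N * morreyNorm q α b ^ p * eLpNorm f (ENNReal.ofReal p) volume ^ p) ∧
      (∀ u : Spacetime d → ℝ, ContDiff ℝ 2 u → HasCompactSupport u →
        ∫⁻ z, ‖b z‖ₑ ^ p * ‖spaceGrad u z‖ₑ ^ p ≤
          N * morreyNorm q 1 b ^ p *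
            eLpNorm (hessTimeNorm u) (ENNReal.ofReal p) volume ^ p) := by
  simp only [eLpNorm_ofReal_rpow (zero_lt_one.trans hp)]
  obtain ⟨K, hK⟩ := exists_potential_le_dyadicRiesz d hα.le
  obtain ⟨L, hL⟩ := exists_enorm_spaceGrad_le_dyadicRiesz d
  obtain ⟨N, hN⟩ := exists_lintegral_mul_rpow_le_of_le_dyadicRiesz d hp hpq hα K
  obtain ⟨M, hM⟩ := exists_lintegral_mul_rpow_le_of_le_dyadicRiesz d hp hpq one_pos L
  refine ⟨max N M, fun m b hb => ⟨fun f hf => ?_, fun u hu hc => ?_⟩⟩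
  · refine (hN m b hb f _ hf (hK f hf)).trans ?_
    gcongr
    exacts [le_max_left N M, le_rfl]
  · refine (hM m b hb _ _ (continuous_hessTimeNorm hu).measurable.enorm.aemeasurable
      (hL u hu hc)).trans ?_
    gcongr
    exact le_max_right N M

theorem theorem4p1 (d : ℕ) (hd : 1 ≤ d) (p q : ℝ) (hp : 1 < p) (hpq : p < q)
    (hq : q ≤ (d : ℝ) + 2) :
    ∃ N : ℝ≥0, ∀ (m : ℕ) (b : ParabolicMorrey.Spacetime d → EuclideanSpace ℝ (Fin m)),
      ParabolicMorrey.MemMorrey q 1 b →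
      (∀ f : ParabolicMorrey.Spacetime d → ℝ≥0∞, AEMeasurable f volume →
        ∫⁻ z, ‖b z‖ₑ ^ p * ParabolicMorrey.potential 1 f z ^ p ≤
          N * ParabolicMorrey.morreyNorm q 1 b ^ p *
            eLpNorm f (ENNReal.ofReal p) volume ^ p) ∧
      (∀ u : ParabolicMorrey.Spacetime d → ℝ, ContDiff ℝ ∞ u → HasCompactSupport u →
        ∫⁻ z, ‖b z‖ₑ ^ p * ‖ParabolicMorrey.spaceGrad u z‖ₑ ^ p ≤
          N * ParabolicMorrey.morreyNorm q 1 b ^ p *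
            eLpNorm (ParabolicMorrey.hessTimeNorm u) (ENNReal.ofReal p) volume ^ p) :=
  have ⟨N, hN⟩ := theorem4p1_general d hp hpq one_pos
  ⟨N, fun m b hb => (hN m b hb.1).imp_right fun h u hu => h u (contDiff_infty.1 hu 2)⟩
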